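/- **Conventions.** Morphisms are composed from left to right. A *category with subobjects* is a small category $\mathcal C$ (object set $v\mathcal C$) with a subcategory $\mathcal P$, $v\mathcal P=v\mathcal C$, that is a strict preorder (at most one morphism between two objects, only identities as isomorphisms), all of whose morphisms (*inclusions* $j(c',c)\colon c'\to c$; one writes $c'\subseteq c$) are monomorphisms in $\mathcal C$, and such that $f=hg$ with $f,g\in\mathcal P$ implies $h\in\mathcal P$. A *retraction* is a right inverse $q$ of an inclusion, $j(c',c)q=1_{c'}$. A *normal cone* with apex $d$ is a family of morphisms $\gamma(c)\colon c\to d$ $(c\in v\mathcal C)$ with $j(c,c')\gamma(c')=\gamma(c)$ whenever $c\subseteq c'$, at least one $\gamma(c)$ being an isomorphism; the apex is denoted $c_\gamma$. $\mathcal C$ is *normal* if every morphism is a product $f=quj$ of a retraction, an isomorphism and an inclusion, every inclusion splits, and every object $c$ is the apex of a normal cone with $\gamma(c)=1_c$. In a normal category $f^\circ=qu$ depends only on $f$, and for a normal cone $\gamma$ and $f\colon c_\gamma\to c$ the components $\gamma(a)f^\circ$ form a normal cone $\gamma*f^\circ$. The *$H$-functor* $H(\gamma;-)\colon\mathcal C\to\mathbf{Set}$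 is $H(\gamma;c)=\{\gamma*f^\circ: f\in\mathcal C(c_\gamma,c)\}$, $H(\gamma;g)\colon\gamma*f^\circ\mapsto\gamma*(fg)^\circ$, and $\eta_\gamma\colon H(\gamma;-)\to\mathcal C(c_\gamma,-)$, $\gamma*f^\circ\mapsto f$, is a natural isomorphism. The *normal dual* $N^*\mathcal C$ is the full subcategory of $[\mathcal C,\mathbf{Set}]$ on the $H$-functors; its inclusions are the natural transformations all of whose components are inclusions of sets. The *ideal* $\langle c\rangle$ is the full subcategory on the objects $d\subseteq c$. A functor $F\colon\mathcal C\to\mathcal D$ between normal categories is a *local isomorphism* if it maps inclusions to inclusions, is fully faithful, and for each $c\in v\mathcal C$ restricts to an isomorphism (bijective on objects and fully faithful) of $\langle c\rangle$ onto $\langle F(c)\rangle$. **The categories.** Let $S$ be a regular semigroup with set of idempotents $E$. For $e,f\in E$ put $e\,\omega^l f\iff ef=e$, $e\,\omega^r f\iff fe=e$, $\omega=\omega^l\cap\omega^r$, $\mathscr L=\omega^l\cap(\omega^l)^{-1}$, $\mathscr R=\omega^r\cap(\omega^r)^{-1}$. The inductive groupoid $\mathcal G(S)$ has object set $E$ and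 as morphisms from $e$ to $f$ the pairs $(x,x')$ of mutually inverse elements ($xx'x=x$, $x'xx'=x'$) with $xx'=e$, $x'x=f$. The category $\mathcal L_G$ has object set $E/\mathscr L$ (class of $e$: $\overleftarrow e$). Its morphisms are generated by the arrows $r(e,e,f)\colon\overleftarrow e\to\overleftarrow f$ with $e\,\omega^l f$ (the inclusions), $r(e,u,f)$ with $u\in E$, $u\,\mathscr L\, f$, $u\,\omega\, e$, and $r(e,x,f)$ with $(x,x')\in\mathcal G(S)$ from $e$ to $f$, under the composition $r(e,u,f)\,r(g,v,h)=r(e,uv,h)$ for $f\,\mathscr L\,g$, where $r(e,u,f)$ and $r(g,v,h)$ are identified if and only if $e\,\mathscr L\,g$, $f\,\mathscr L\,h$ and $u=ev$; thus the morphisms $\overleftarrow e\to\overleftarrow f$ are the $r(e,u,f)$ with $u\in eSf$. Dually $\mathcal R_G$ has object set $E/\mathscr R$ (class of $e$: $\overrightarrow e$). Its morphisms are generated by the arrows $l(e,e,f)\colon\overrightarrow e\to\overrightarrow f$ with $e\,\omega^r f$ (the inclusions), $l(e,u,f)$ with $u\in E$, $u\,\mathscr R\,f$, $u\,\omega\,e$,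 and $l(e,x',f)$ with $(x,x')\in\mathcal G(S)$ from $e$ to $f$, under the composition $l(e,u,f)\,l(g,v,h)=l(e,vu,h)$ for $f\,\mathscr R\,g$, where $l(e,u,f)$ and $l(g,v,h)$ are identified if and only if $e\,\mathscr R\,g$, $f\,\mathscr R\,h$ and $u=ve$; thus the morphisms $\overrightarrow e\to\overrightarrow f$ are the $l(e,u,f)$ with $u\in fSe$. The category $\mathcal L_G$ is normal. For $e\in E$ let $r^e$ be the normal cone in $\mathcal L_G$ with apex $\overleftarrow e$ and components $r^e(\overleftarrow g)=r(g,ge,e)$. Let $\Gamma_G\colon\mathcal R_G\to N^*\mathcal L_G$ be the functor $$\Gamma_G(\overrightarrow e)=H(r^e;-),\qquad \Gamma_G(l(e,u,f))=\eta_{r^e}\;\mathcal L_G(r(f,u,e),-)\;\eta_{r^f}^{-1}.$$ **Proposition.** For every regular semigroup $S$, the functor $\Gamma_G$ is a local isomorphism: $\mathcal R_G$ and $N^*\mathcal L_G$ are normal categories, $\Gamma_G$ maps inclusions to inclusions, it is fully faithful, and for every object $c$ of $\mathcal R_G$ it restricts to an isomorphism of the ideal $\langle c\rangle$ onto the ideal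 $\langle\Gamma_G(c)\rangle$. -/

import Mathlib

open CategoryTheory

universe u

namespace CrossConn

/-! ### Categories with subobjects and normal categories -/

/-- A small category `C` with a choice of subobjects: a wide subcategory of "inclusions" which is a
strict preorder, all of whose morphisms are monomorphisms of `C`, and such that `f = h ≫ g` with
`f`, `g` inclusions forces `h` to be an inclusion. -/
class CategoryWithSubobjects (C : Type u) [SmallCategory C] where
  /-- `Incl f` says that `f` is an inclusion. -/
  Incl : ∀ {a b : C}, (a ⟶ b) → Prop
  id_mem : ∀ c : C, Incl (𝟙 c)
  comp_mem : ∀ {a b c : C} (f : a ⟶ b) (g : b ⟶ c), Incl f → Incl g → Incl (f ≫ g)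
  /-- There is at most one inclusion from one object to another. -/
  unique : ∀ {a b : C} (f g : a ⟶ b), Incl f → Incl g → f = g
  /-- The preorder is strict. -/
  antisymm : ∀ {a b : C} (f : a ⟶ b) (g : b ⟶ a), Incl f → Incl g → a = b
  mono : ∀ {a b : C} (f : a ⟶ b), Incl f → Mono f
  left_mem : ∀ {a b c : C} (h : a ⟶ b) (g : b ⟶ c), Incl g → Incl (h ≫ g) → Incl h

open CategoryWithSubobjects

section Normal

variable {C : Type u} [SmallCategory C] [CategoryWithSubobjects C]

/-- `a ⊆ b`: there is an inclusion from `a` to `b`. -/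
def IsSub (a b : C) : Prop := ∃ j : a ⟶ b, Incl j

/-- A retraction is a morphism that splits an inclusion. -/
def IsRetraction {a b : C} (q : a ⟶ b) : Prop := ∃ j : b ⟶ a, Incl j ∧ j ≫ q = 𝟙 b

/-- A normal factorization `f = q u j`: a retraction, followed by an isomorphism, followed by an
inclusion. -/
structure NormalFactorization {c d : C} (f : c ⟶ d) where
  c' : C
  d' : C
  q : c ⟶ c'
  u : c' ⟶ d'
  j : d' ⟶ d
  isRetraction_q : IsRetraction q
  isIso_u : IsIso u
  incl_j : Incl j
  fac : q ≫ u ≫ j = f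

/-- `γ` is a normal cone with apex `d`. -/
structure IsNormalCone {d : C} (γ : ∀ c : C, c ⟶ d) : Prop where
  incl_comp : ∀ {c c' : C} (j : c ⟶ c'), Incl j → j ≫ γ c' = γ c
  exists_isIso : ∃ c : C, IsIso (γ c)

variable (C) in
/-- A normal category. -/
class IsNormalCategory : Prop where
  exists_factorization : ∀ {c d : C} (f : c ⟶ d), Nonempty (NormalFactorization f)
  incl_splits : ∀ {c c' : C} (j : c ⟶ c'), Incl j → ∃ q : c' ⟶ c, j ≫ q = 𝟙 c
  exists_cone : ∀ c : C, ∃ γ : (∀ a : C, a ⟶ c), IsNormalCone γ ∧ γ c = 𝟙 c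

variable (C) in
/-- The set of all normal cones of `C` (the underlying set of the semigroup `TC`). -/
structure NormalCone where
  apex : C
  comp : ∀ c : C, c ⟶ apex
  isNormal : IsNormalCone comp

/-- Two normal cones coincide as soon as they do so after composition with inclusions of their
apices into a common object. -/
theorem NormalCone.ext_of_incl (α β : NormalCone C) {c : C} (i : α.apex ⟶ c) (j : β.apex ⟶ c)
    (hi : Incl i) (hj : Incl j) (h : ∀ k, α.comp k ≫ i = β.comp k ≫ j) : α = β := by
  obtain ⟨a, α, hα⟩ := α
  obtain ⟨b, β, hβ⟩ := β
  dsimp only at i j h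
  obtain ⟨k, hk⟩ := hα.exists_isIso
  obtain ⟨l, hl⟩ := hβ.exists_isIso
  have h1 : Incl (inv (α k) ≫ β k) := by
    refine left_mem _ j hj ?_
    rw [Category.assoc, ← h k, IsIso.inv_hom_id_assoc]; exact hi
  have h2 : Incl (inv (β l) ≫ α l) := by
    refine left_mem _ i hi ?_
    rw [Category.assoc, h l, IsIso.inv_hom_id_assoc]; exact hj
  obtain rfl := antisymm _ _ h1 h2
  obtain rfl := unique _ _ hi hj
  have := mono i hi
  congr 1
  funext m
  exact (cancel_mono i).1 (h m)

theorem NormalFactorization.splitEpi {c d : C} {f : c ⟶ d} (F : NormalFactorization f) :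
    ∃ s : F.d' ⟶ c, s ≫ F.q ≫ F.u = 𝟙 _ := by
  obtain ⟨j, -, hj⟩ := F.isRetraction_q
  have := F.isIso_u
  exact ⟨inv F.u ≫ j, by rw [Category.assoc, reassoc_of% hj, IsIso.inv_hom_id]⟩

/-- The epimorphic component of a morphism is the same for all its normal factorizations. -/
theorem NormalFactorization.epi_unique {c d : C} {f : c ⟶ d} (F G : NormalFactorization f) :
    F.d' = G.d' ∧ HEq (F.q ≫ F.u) (G.q ≫ G.u) := by
  obtain ⟨s, hs⟩ := F.splitEpi
  obtain ⟨t, ht⟩ := G.splitEpi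
  have e : (F.q ≫ F.u) ≫ F.j = (G.q ≫ G.u) ≫ G.j := by
    rw [Category.assoc, Category.assoc, F.fac, G.fac]
  have h1 : Incl (s ≫ G.q ≫ G.u) := by
    refine left_mem _ G.j G.incl_j ?_
    rw [Category.assoc, ← e, ← Category.assoc, hs, Category.id_comp]; exact F.incl_j
  have h2 : Incl (t ≫ F.q ≫ F.u) := by
    refine left_mem _ F.j F.incl_j ?_
    rw [Category.assoc, e, ← Category.assoc, ht, Category.id_comp]; exact G.incl_j
  have hd := antisymm _ _ h1 h2
  refine ⟨hd, ?_⟩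
  obtain ⟨c1, d1, q1, u1, j1, hq1, hu1, hj1, f1⟩ := F
  obtain ⟨c2, d2, q2, u2, j2, hq2, hu2, hj2, f2⟩ := G
  dsimp only at *
  subst hd
  obtain rfl := unique _ _ hj1 hj2
  have := mono j1 hj1
  exact heq_of_eq ((cancel_mono j1).1 e)

variable [IsNormalCategory C]

/-- A chosen normal factorization; the epimorphic component does not depend on the choice, see
`NormalFactorization.epi_unique`. -/
noncomputable def normalFact {c d : C} (f : c ⟶ d) : NormalFactorization f :=
  Classical.choice (IsNormalCategory.exists_factorization f)

/-- The codomain of the epimorphic component of `f`. -/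
noncomputable def im {c d : C} (f : c ⟶ d) : C := (normalFact f).d'

/-- The epimorphic component `f° = q u` of a morphism `f = q u j`. -/
noncomputable def epiComp {c d : C} (f : c ⟶ d) : c ⟶ im f := (normalFact f).q ≫ (normalFact f).u

/-- The inclusion of the codomain of `f°` into the codomain of `f`. -/
noncomputable def imIncl {c d : C} (f : c ⟶ d) : im f ⟶ d := (normalFact f).j

theorem incl_imIncl {c d : C} (f : c ⟶ d) : Incl (imIncl f) := (normalFact f).incl_j

theorem epiComp_imIncl {c d : C} (f : c ⟶ d) : epiComp f ≫ imIncl f = f := by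
  exact (Category.assoc _ _ _).trans (normalFact f).fac

instance epi_epiComp {c d : C} (f : c ⟶ d) : Epi (epiComp f) := by
  obtain ⟨s, hs⟩ := (normalFact f).splitEpi
  exact (SplitEpi.mk s hs).epi

/-- If `γ` is a normal cone and `f` is an epimorphism from its apex, the cone with components
`γ(a) f` is normal. -/
theorem isNormalCone_star {b d : C} {γ : ∀ c : C, c ⟶ b} (hγ : IsNormalCone γ) (f : b ⟶ d)
    [Epi f] : IsNormalCone (fun a => γ a ≫ f) := by
  refine ⟨fun j hj => by rw [← Category.assoc, hγ.incl_comp j hj], ?_⟩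
  obtain ⟨c, hc⟩ := hγ.exists_isIso
  obtain ⟨⟨b', d', q, u, j, ⟨i, hi, hiq⟩, hu, hj, fac⟩⟩ := IsNormalCategory.exists_factorization f
  -- `j` is an isomorphism
  have hjiso : IsIso j := by
    obtain ⟨r, hr⟩ := IsNormalCategory.incl_splits j hj
    have : Epi j := by
      have h1 : Epi ((q ≫ u) ≫ j) := by rw [Category.assoc, fac]; infer_instance
      exact epi_of_epi (q ≫ u) j
    refine ⟨r, hr, ?_⟩
    rw [← cancel_epi j, reassoc_of% hr, Category.comp_id]
  -- a subobject of `c` isomorphic to `b'` through `γ c`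
  obtain ⟨⟨x, y, q', v, k, ⟨i', hi', hiq'⟩, hv, hk, fac'⟩⟩ :=
    IsNormalCategory.exists_factorization (i ≫ inv (γ c))
  have hmono := mono i hi
  have hq'iso : IsIso q' := by
    have h1 : Mono q' := by
      have : Mono (q' ≫ v ≫ k) := by rw [fac']; infer_instance
      exact mono_of_mono q' (v ≫ k)
    refine ⟨i', ?_, hiq'⟩
    rw [← cancel_mono q', Category.assoc, hiq', Category.comp_id, Category.id_comp]
  refine ⟨y, ?_⟩
  have e1 : γ y = inv (q' ≫ v) ≫ i := by
    rw [← hγ.incl_comp k hk, IsIso.eq_inv_comp, ← Category.assoc, Category.assoc q', fac',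
      Category.assoc, IsIso.inv_hom_id, Category.comp_id]
  have e2 : γ y ≫ f = inv (q' ≫ v) ≫ u ≫ j := by
    rw [e1, ← fac, Category.assoc, reassoc_of% hiq]
  rw [e2]
  infer_instance

/-- The normal cone `γ ∗ f`, for an epimorphism `f` from the apex of `γ`. -/
def NormalCone.star (γ : NormalCone C) {d : C} (f : γ.apex ⟶ d) [Epi f] : NormalCone C where
  apex := d
  comp a := γ.comp a ≫ f
  isNormal := isNormalCone_star γ.isNormal f

/-- The cone `γ ∗ f°`, for any morphism `f` from the apex of `γ`. -/
noncomputable def NormalCone.starEpi (γ : NormalCone C) {d : C} (f : γ.apex ⟶ d) : NormalCone C :=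
  γ.star (epiComp f)

theorem starEpi_comp_imIncl (γ : NormalCone C) {d : C} (f : γ.apex ⟶ d) (k : C) :
    (γ.starEpi f).comp k ≫ imIncl f = γ.comp k ≫ f :=
  (Category.assoc _ _ _).trans (congrArg _ (epiComp_imIncl f))

theorem starEpi_eq_iff (γ δ : NormalCone C) {d : C} (f : γ.apex ⟶ d) (g : δ.apex ⟶ d) :
    γ.starEpi f = δ.starEpi g ↔ ∀ k, γ.comp k ≫ f = δ.comp k ≫ g := by
  constructor
  · intro h k
    rw [← starEpi_comp_imIncl, ← starEpi_comp_imIncl]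
    have key : ∀ (α β : NormalCone C) (i : α.apex ⟶ d) (j : β.apex ⟶ d), Incl i → Incl j → α = β →
        α.comp k ≫ i = β.comp k ≫ j := by
      rintro α _ i j hi hj rfl
      rw [unique _ _ hi hj]
    exact key _ _ (imIncl f) (imIncl g) (incl_imIncl f) (incl_imIncl g) h
  · intro h
    refine NormalCone.ext_of_incl _ _ (imIncl f) (imIncl g) (incl_imIncl f) (incl_imIncl g) ?_
    intro k
    rw [starEpi_comp_imIncl, starEpi_comp_imIncl, h]

theorem starEpi_injective (γ : NormalCone C) (d : C) :
    Function.Injective (fun f : γ.apex ⟶ d => γ.starEpi f) := by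
  intro f g h
  obtain ⟨c, hc⟩ := γ.isNormal.exists_isIso
  exact (cancel_epi (γ.comp c)).1 ((starEpi_eq_iff γ γ f g).1 h c)

end Normal

/-! ### Set-valued functors, `H`-functors and the normal dual -/

/-- The category of subsets of a set `X` and all functions between them: a full subcategory of the
category of sets. -/
structure SubsetCat (X : Type u) where
  carrier : Set X

instance (X : Type u) : SmallCategory (SubsetCat X) where
  Hom A B := A.carrier → B.carrier
  id A := fun x => x
  comp f g := fun x => g (f x)

/-- The inclusion of `SubsetCat X` into the category of sets. -/
def SubsetCat.toType (X : Type u) : SubsetCat X ⥤ Type u where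
  obj A := A.carrier
  map f := TypeCat.ofHom f

/-- A natural transformation between functors with values in subsets of `X`, obtained from one
between the same functors regarded as set-valued functors. -/
def SubsetCat.liftTrans {C : Type u} [SmallCategory C] {X : Type u} {F G : C ⥤ SubsetCat X}
    (t : F ⋙ SubsetCat.toType X ⟶ G ⋙ SubsetCat.toType X) : F ⟶ G where
  app c := fun x => (t.app c) x
  naturality c d f := by
    funext x
    exact congrArg (fun (φ : (F ⋙ SubsetCat.toType X).obj c ⟶ (G ⋙ SubsetCat.toType X).obj d) =>
      φ x) (t.naturality f)

theorem SubsetCat.functor_ext {C : Type u} [SmallCategory C] {X : Type u} {F G : C ⥤ SubsetCat X}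
    (hobj : ∀ c, (F.obj c).carrier = (G.obj c).carrier)
    (hmap : ∀ (c d : C) (g : c ⟶ d) (x : X) (hx : x ∈ (F.obj c).carrier)
      (hx' : x ∈ (G.obj c).carrier),
      ((F.map g : (F.obj c).carrier → (F.obj d).carrier) ⟨x, hx⟩ : X) =
        (G.map g : (G.obj c).carrier → (G.obj d).carrier) ⟨x, hx'⟩) : F = G := by
  obtain ⟨Fo, Fm, hF1, hF2⟩ := F
  obtain ⟨Go, Gm, hG1, hG2⟩ := G
  dsimp only at hobj hmap
  have h : Fo = Go := funext fun c => congrArg SubsetCat.mk (hobj c)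
  subst h
  have h : @Fm = @Gm := by
    funext c d g x
    exact Subtype.ext (hmap c d g x.1 x.2 x.2)
  subst h
  rfl

section Dual

variable {C : Type u} [SmallCategory C] [CategoryWithSubobjects C] [IsNormalCategory C]

/-- The set `H(γ; c) = {γ ∗ f° : f ∈ C(c_γ, c)}`. -/
def Hset (γ : NormalCone C) (c : C) : Set (NormalCone C) :=
  {α | ∃ f : γ.apex ⟶ c, γ.starEpi f = α}

/-- The bijection `γ ∗ f° ↦ f` from `H(γ; c)` to `C(c_γ, c)`. -/
noncomputable def HsetEquiv (γ : NormalCone C) (c : C) : Hset γ c ≃ (γ.apex ⟶ c) :=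
  (Equiv.ofBijective (fun f : γ.apex ⟶ c => (⟨γ.starEpi f, f, rfl⟩ : Hset γ c))
    ⟨fun _ _ h => starEpi_injective γ c (congrArg Subtype.val h),
      fun ⟨_, f, hf⟩ => ⟨f, Subtype.ext hf⟩⟩).symm

theorem HsetEquiv_symm_coe (γ : NormalCone C) (c : C) (f : γ.apex ⟶ c) :
    ((HsetEquiv γ c).symm f : NormalCone C) = γ.starEpi f := rfl

/-- The `H`-functor `H(γ; -)`: it maps `g : c ⟶ d` to `γ ∗ f° ↦ γ ∗ (f g)°`. -/
noncomputable def Hfunctor (γ : NormalCone C) : C ⥤ SubsetCat (NormalCone C) where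
  obj c := ⟨Hset γ c⟩
  map {c d} g := fun α => (HsetEquiv γ d).symm (HsetEquiv γ c α ≫ g)
  map_id c := by
    funext α
    simp only [Category.comp_id, Equiv.symm_apply_apply]
    rfl
  map_comp f g := by
    funext α
    change _ = (HsetEquiv γ _).symm (HsetEquiv γ _ ((HsetEquiv γ _).symm _) ≫ g)
    rw [Equiv.apply_symm_apply, Category.assoc]

theorem Hfunctor_map_starEpi (γ : NormalCone C) {c d : C} (f : γ.apex ⟶ c) (g : c ⟶ d) :
    (((Hfunctor γ).map g : Hset γ c → Hset γ d) ⟨γ.starEpi f, f, rfl⟩ : NormalCone C) =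
      γ.starEpi (f ≫ g) := by
  change γ.starEpi (HsetEquiv γ c ((HsetEquiv γ c).symm f) ≫ g) = _
  rw [Equiv.apply_symm_apply]

/-- The natural isomorphism `η_γ : H(γ; -) ⟶ C(c_γ, -)`, `γ ∗ f° ↦ f`. -/
noncomputable def eta (γ : NormalCone C) :
    Hfunctor γ ⋙ SubsetCat.toType (NormalCone C) ≅ coyoneda.obj (Opposite.op γ.apex) :=
  NatIso.ofComponents (fun c => (HsetEquiv γ c).toIso) (by
    intro c d g
    ext α
    exact (HsetEquiv γ d).apply_symm_apply _)

variable (C) in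
/-- The normal dual `N*C`: the full subcategory of the category of set-valued functors on `C` (and
natural transformations) whose objects are the `H`-functors. All values of `H`-functors are subsets
of the set of normal cones. -/
abbrev NormalDual : Type u :=
  ObjectProperty.FullSubcategory
    (fun F : C ⥤ SubsetCat (NormalCone C) => ∃ γ : NormalCone C, Hfunctor γ = F)

/-- `H(γ; -)` as an object of the normal dual. -/
noncomputable def Hobj (γ : NormalCone C) : NormalDual C := ⟨Hfunctor γ, γ, rfl⟩

/-- The component at `c` of a morphism of the normal dual, as a function. -/
def NormalDual.app {F G : NormalDual C} (t : F ⟶ G) (c : C) :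
    (F.obj.obj c).carrier → (G.obj.obj c).carrier := t.hom.app c

theorem NormalDual.hom_ext' {F G : NormalDual C} {s t : F ⟶ G}
    (h : ∀ c x, (NormalDual.app s c x : NormalCone C) = NormalDual.app t c x) : s = t := by
  apply ObjectProperty.hom_ext
  apply NatTrans.ext
  funext c
  funext x
  exact Subtype.ext (h c x)

/-- Inclusions of the normal dual: natural transformations all of whose components are inclusions
of sets. -/
def NormalDual.IsIncl {F G : NormalDual C} (t : F ⟶ G) : Prop :=
  ∀ (c : C) (x : (F.obj.obj c).carrier), (NormalDual.app t c x : NormalCone C) = x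

theorem NormalDual.app_comp {F G K : NormalDual C} (s : F ⟶ G) (t : G ⟶ K) (c : C)
    (x : (F.obj.obj c).carrier) :
    NormalDual.app (s ≫ t) c x = NormalDual.app t c (NormalDual.app s c x) := rfl

theorem NormalDual.app_id (F : NormalDual C) (c : C) (x : (F.obj.obj c).carrier) :
    NormalDual.app (𝟙 F) c x = x := rfl

theorem NormalDual.app_naturality {F G : NormalDual C} (t : F ⟶ G) {c d : C} (g : c ⟶ d)
    (x : (F.obj.obj c).carrier) :
    NormalDual.app t d ((F.obj.map g : (F.obj.obj c).carrier → (F.obj.obj d).carrier) x) =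
      (G.obj.map g : (G.obj.obj c).carrier → (G.obj.obj d).carrier) (NormalDual.app t c x) :=
  congrFun (t.hom.naturality g) x

theorem NormalDual.app_eqToHom {F G : NormalDual C} (h : F = G) (c : C)
    (x : (F.obj.obj c).carrier) :
    (NormalDual.app (eqToHom h) c x : NormalCone C) = x := by
  subst h
  rfl

instance : CategoryWithSubobjects (NormalDual C) where
  Incl t := NormalDual.IsIncl t
  id_mem F c x := rfl
  comp_mem f g hf hg c x := by rw [NormalDual.app_comp, hg, hf]
  unique f g hf hg := NormalDual.hom_ext' fun c x => by rw [hf, hg]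
  antisymm {F G} f g hf hg := by
    have h1 : ∀ c x, x ∈ (F.obj.obj c).carrier → x ∈ (G.obj.obj c).carrier := fun c x hx => by
      have := (NormalDual.app f c ⟨x, hx⟩).2
      rwa [hf] at this
    have h2 : ∀ c x, x ∈ (G.obj.obj c).carrier → x ∈ (F.obj.obj c).carrier := fun c x hx => by
      have := (NormalDual.app g c ⟨x, hx⟩).2
      rwa [hg] at this
    refine ObjectProperty.FullSubcategory.ext
      (SubsetCat.functor_ext (fun c => Set.ext fun x => ⟨h1 c x, h2 c x⟩) ?_)
    intro c d k x hx hx'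
    have e := congrArg Subtype.val (NormalDual.app_naturality f k ⟨x, hx⟩)
    rw [hf] at e
    rw [e]
    have e2 : NormalDual.app f c ⟨x, hx⟩ = ⟨x, hx'⟩ := Subtype.ext (hf c _)
    rw [e2]
  mono {F G} f hf := by
    refine ⟨fun s t h => NormalDual.hom_ext' fun c x => ?_⟩
    have := congrArg (fun k => (NormalDual.app k c x : NormalCone C)) h
    rwa [NormalDual.app_comp, NormalDual.app_comp, hf, hf] at this
  left_mem h g hg hhg c x := by
    have := hhg c x
    rwa [NormalDual.app_comp, hg] at this

/-- Equality of `H`-functors of cones that differ by an isomorphism of the apices. -/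
theorem Hobj_eq (γ δ : NormalCone C) (h : γ.apex ⟶ δ.apex) (k : δ.apex ⟶ γ.apex)
    (hh : ∀ a, γ.comp a ≫ h = δ.comp a) (hk : ∀ a, δ.comp a ≫ k = γ.comp a) :
    Hobj γ = Hobj δ := by
  have e1 : ∀ {c : C} (f : γ.apex ⟶ c), γ.starEpi f = δ.starEpi (k ≫ f) := fun f =>
    (starEpi_eq_iff _ _ _ _).2 fun a => by rw [← Category.assoc, hk]
  have e2 : ∀ {c : C} (f : δ.apex ⟶ c), δ.starEpi f = γ.starEpi (h ≫ f) := fun f =>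
    (starEpi_eq_iff _ _ _ _).2 fun a => by rw [← Category.assoc, hh]
  refine ObjectProperty.FullSubcategory.ext
    (SubsetCat.functor_ext (fun c => Set.ext fun x => ⟨?_, ?_⟩) ?_)
  · rintro ⟨f, rfl⟩
    exact ⟨k ≫ f, (e1 f).symm⟩
  · rintro ⟨f, rfl⟩
    exact ⟨h ≫ f, (e2 f).symm⟩
  · rintro c d g _ ⟨f, rfl⟩ ⟨f', hf'⟩
    refine (Hfunctor_map_starEpi γ f g).trans ?_
    have e3 : (⟨γ.starEpi f, f', hf'⟩ : Hset δ c) = ⟨δ.starEpi f', f', rfl⟩ :=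
      Subtype.ext hf'.symm
    refine Eq.trans ?_ (congrArg (fun z => (((Hfunctor δ).map g : Hset δ c → Hset δ d) z :
      NormalCone C)) e3.symm)
    refine Eq.trans ?_ (Hfunctor_map_starEpi δ f' g).symm
    rw [starEpi_eq_iff] at hf' ⊢
    intro a
    rw [← Category.assoc, ← Category.assoc, hf']

/-- The morphism `η_γ C(r, -) η_δ⁻¹ : H(γ; -) ⟶ H(δ; -)` of the normal dual determined by
`r : c_δ ⟶ c_γ`. -/
noncomputable def Hmap (γ δ : NormalCone C) (r : δ.apex ⟶ γ.apex) : Hobj γ ⟶ Hobj δ :=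
  ObjectProperty.homMk (SubsetCat.liftTrans
    ((eta γ).hom ≫ coyoneda.map r.op ≫ (eta δ).inv))

theorem Hmap_app (γ δ : NormalCone C) (r : δ.apex ⟶ γ.apex) {c : C} (f : γ.apex ⟶ c)
    (h : γ.starEpi f ∈ Hset γ c) :
    (NormalDual.app (Hmap γ δ r) c ⟨γ.starEpi f, h⟩ : NormalCone C) = δ.starEpi (r ≫ f) := by
  change δ.starEpi (r ≫ HsetEquiv γ c ((HsetEquiv γ c).symm f)) = _
  rw [Equiv.apply_symm_apply]

end Dual

/-! ### Local isomorphisms -/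

section Local

/-- The ideal `⟨c⟩`: the full subcategory of the objects `d ⊆ c`. -/
abbrev PrincipalIdeal {C : Type u} [SmallCategory C] [CategoryWithSubobjects C] (c : C) : Type u :=
  ObjectProperty.FullSubcategory (fun d : C => IsSub d c)

variable {C D : Type u} [SmallCategory C] [CategoryWithSubobjects C]
  [SmallCategory D] [CategoryWithSubobjects D]

/-- A functor that maps inclusions to inclusions. -/
def InclusionPreserving (F : C ⥤ D) : Prop :=
  ∀ {a b : C} (j : a ⟶ b), Incl j → Incl (F.map j)

/-- The restriction of an inclusion preserving functor to `⟨c⟩`, with values in `⟨F(c)⟩`. -/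
def restrictIdeal (F : C ⥤ D) (hF : InclusionPreserving F) (c : C) :
    PrincipalIdeal c ⥤ PrincipalIdeal (F.obj c) :=
  ObjectProperty.lift _ (ObjectProperty.ι _ ⋙ F)
    (fun d => let ⟨j, hj⟩ := d.property; ⟨F.map j, hF j hj⟩)

/-- A functor is an isomorphism of categories if it is bijective on objects and fully faithful. -/
structure IsCategoryIso {A B : Type u} [SmallCategory A] [SmallCategory B] (F : A ⥤ B) : Prop where
  obj_bijective : Function.Bijective F.obj
  full : F.Full
  faithful : F.Faithful

/-- A local isomorphism of normal categories. -/
structure IsLocalIsomorphism (F : C ⥤ D) : Prop where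
  normal_source : IsNormalCategory C
  normal_target : IsNormalCategory D
  inclusionPreserving : InclusionPreserving F
  full : F.Full
  faithful : F.Faithful
  iso_on_ideals : ∀ c : C, IsCategoryIso (restrictIdeal F inclusionPreserving c)

end Local

/-! ### Regular semigroups, idempotents and the groupoid `G(S)` -/

/-- `b` is an inverse of `a`. -/
def IsInverse {S : Type u} [Semigroup S] (a b : S) : Prop := a * b * a = a ∧ b * a * b = b

/-- A regular semigroup: every element has an inverse. -/
class IsRegularSemigroup (S : Type u) [Semigroup S] : Prop where
  exists_inverse : ∀ a : S, ∃ b : S, IsInverse a b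

/-- The set `E` of idempotents of `S`. -/
@[ext]
structure Idem (S : Type u) [Semigroup S] where
  val : S
  idem : val * val = val

section Biorder

variable {S : Type u} [Semigroup S]

/-- The quasi-order `ω^l`. -/
def OmegaL (e f : Idem S) : Prop := e.val * f.val = e.val

/-- The quasi-order `ω^r`. -/
def OmegaR (e f : Idem S) : Prop := f.val * e.val = e.val

/-- Green's relation `L` on idempotents. -/
def GreenL (e f : Idem S) : Prop := OmegaL e f ∧ OmegaL f e

/-- Green's relation `R` on idempotents. -/
def GreenR (e f : Idem S) : Prop := OmegaR e f ∧ OmegaR f e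

theorem OmegaL.trans {e f g : Idem S} (h : OmegaL e f) (k : OmegaL f g) : OmegaL e g := by
  unfold OmegaL at *
  rw [← h, mul_assoc, k]

theorem OmegaR.trans {e f g : Idem S} (h : OmegaR e f) (k : OmegaR f g) : OmegaR e g := by
  unfold OmegaR at *
  rw [← h, ← mul_assoc, k]

theorem GreenL.refl (e : Idem S) : GreenL e e := ⟨e.idem, e.idem⟩

theorem GreenR.refl (e : Idem S) : GreenR e e := ⟨e.idem, e.idem⟩

theorem GreenL.symm {e f : Idem S} (h : GreenL e f) : GreenL f e := ⟨h.2, h.1⟩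

theorem GreenR.symm {e f : Idem S} (h : GreenR e f) : GreenR f e := ⟨h.2, h.1⟩

theorem GreenL.trans {e f g : Idem S} (h : GreenL e f) (k : GreenL f g) : GreenL e g :=
  ⟨h.1.trans k.1, k.2.trans h.2⟩

theorem GreenR.trans {e f g : Idem S} (h : GreenR e f) (k : GreenR f g) : GreenR e g :=
  ⟨h.1.trans k.1, k.2.trans h.2⟩

/-- A morphism `(x, x')` from `e = x x'` to `f = x' x` of the inductive groupoid `G(S)`. -/
@[ext]
structure GHom (e f : Idem S) where
  x : S
  x' : S
  inverse : IsInverse x x'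
  dom_eq : x * x' = e.val
  cod_eq : x' * x = f.val

/-- The inductive groupoid `G(S)` as a groupoid, with `(x, x') (y, y') = (x y, y' x')` and
`(x, x')⁻¹ = (x', x)`. -/
instance : Groupoid (Idem S) where
  Hom e f := GHom e f
  id e := ⟨e.val, e.val, ⟨by rw [e.idem, e.idem], by rw [e.idem, e.idem]⟩, e.idem, e.idem⟩
  comp {e f g} p q := by
    have h1 : p.x * q.x * (q.x' * p.x') = e.val := by
      rw [mul_assoc, ← mul_assoc q.x, q.dom_eq, ← p.cod_eq, ← mul_assoc, ← mul_assoc,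
        p.inverse.1, p.dom_eq]
    have h2 : q.x' * p.x' * (p.x * q.x) = g.val := by
      rw [mul_assoc, ← mul_assoc p.x', p.cod_eq, ← q.dom_eq, ← mul_assoc, ← mul_assoc,
        q.inverse.2, q.cod_eq]
    exact ⟨p.x * q.x, q.x' * p.x',
      ⟨by rw [h1, ← p.dom_eq, ← mul_assoc, p.inverse.1],
        by rw [h2, ← q.cod_eq, ← mul_assoc, q.inverse.2]⟩, h1, h2⟩
  id_comp {e f} p := GHom.ext (by
      change e.val * p.x = p.x
      rw [← p.dom_eq, p.inverse.1]) (by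
      change p.x' * e.val = p.x'
      rw [← p.dom_eq, ← mul_assoc, p.inverse.2])
  comp_id {e f} p := GHom.ext (by
      change p.x * f.val = p.x
      rw [← p.cod_eq, ← mul_assoc, p.inverse.1]) (by
      change f.val * p.x' = p.x'
      rw [← p.cod_eq, p.inverse.2])
  assoc p q r := GHom.ext (mul_assoc _ _ _) (mul_assoc _ _ _).symm
  inv p := ⟨p.x', p.x, ⟨p.inverse.2, p.inverse.1⟩, p.cod_eq, p.dom_eq⟩
  inv_comp {e f} p := GHom.ext p.cod_eq p.cod_eq
  comp_inv {e f} p := GHom.ext p.dom_eq p.dom_eq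

end Biorder

/-- A triple `(e, u, f)`, to be read as a morphism `r(e, u, f)` or `l(e, u, f)`. -/
structure Triple (S : Type u) [Semigroup S] where
  dom : Idem S
  elt : S
  cod : Idem S

/-! ### The category `L_G` -/

section LG

variable {S : Type u} [Semigroup S]

/-- `r(e, e, f)` with `e ω^l f`: the morphisms of `P_L`. -/
def IsPL (t : Triple S) : Prop := t.elt = t.dom.val ∧ OmegaL t.dom t.cod

/-- `r(e, u, f)` with `u ∈ E(L_f) ∩ ω(e)`: the morphisms of `Q_L`. -/
def IsQL (t : Triple S) : Prop :=
  ∃ g : Idem S, g.val = t.elt ∧ GreenL g t.cod ∧ OmegaL g t.dom ∧ OmegaR g t.dom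

/-- `r(e, x, f)` for a morphism `(x, x')` from `e` to `f` of `G(S)`: the morphisms of `G_L`. -/
def IsGL (t : Triple S) : Prop := ∃ p : t.dom ⟶ t.cod, p.x = t.elt

/-- The morphisms generated by the quiver `P_L ∪ Q_L ∪ G_L` under the composition
`r(e, u, f) r(g, v, h) = r(e, u v, h)`, defined when `f` and `g` are `L`-related. (The identities
`r(e, e, e)` belong to `P_L`.) -/
inductive LFree : Triple S → Prop
  | gen (t : Triple S) : IsPL t ∨ IsQL t ∨ IsGL t → LFree t
  | comp (s t : Triple S) : LFree s → LFree t → GreenL s.cod t.dom →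
      LFree ⟨s.dom, s.elt * t.elt, t.cod⟩

/-- `r(e, u, f) ∼ r(g, v, h)` if and only if `e L g`, `f L h` and `u = e v`. -/
def LSim (s t : Triple S) : Prop :=
  GreenL s.dom t.dom ∧ GreenL s.cod t.cod ∧ s.elt = s.dom.val * t.elt

theorem LFree.elt_mem {t : Triple S} (h : LFree t) :
    t.dom.val * t.elt = t.elt ∧ t.elt * t.cod.val = t.elt := by
  induction h with
  | gen t h =>
    rcases h with ⟨h1, h2⟩ | ⟨g, hg, h1, h2, h3⟩ | ⟨p, hp⟩
    · rw [h1]; exact ⟨t.dom.idem, h2⟩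
    · rw [← hg]; exact ⟨h3, h1.1⟩
    · rw [← hp, ← p.dom_eq, ← p.cod_eq, ← mul_assoc]; exact ⟨p.inverse.1, p.inverse.1⟩
  | comp s t hs ht hst ihs iht =>
    exact ⟨by rw [← mul_assoc, ihs.1], by rw [mul_assoc, iht.2]⟩

variable (S) in
/-- The relation `L` as an equivalence relation on `E`. -/
def lSetoid : Setoid (Idem S) := ⟨GreenL, GreenL.refl, GreenL.symm, GreenL.trans⟩

variable (S) in
/-- The object set `E/L` of the category `L_G`. -/
def LG : Type u := Quotient (lSetoid S)

/-- The image of `e` in `E/L`. -/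
def LG.of (e : Idem S) : LG S := Quotient.mk (lSetoid S) e

theorem LG.of_eq_iff {e f : Idem S} : LG.of e = LG.of f ↔ GreenL e f :=
  ⟨fun h => Quotient.exact (s := lSetoid S) h, fun h => Quotient.sound (s := lSetoid S) h⟩

theorem LG.exists_rep (a : LG S) : ∃ e : Idem S, LG.of e = a :=
  Quotient.exists_rep (s := lSetoid S) a

/-- Generated morphisms from `a` to `b`. -/
def LPre (a b : LG S) : Type u :=
  {t : Triple S // LFree t ∧ LG.of t.dom = a ∧ LG.of t.cod = b}

/-- The relation `∼` as an equivalence relation. -/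
def lSimSetoid (a b : LG S) : Setoid (LPre a b) where
  r s t := LSim s.1 t.1
  iseqv :=
    { refl := fun s => ⟨GreenL.refl _, GreenL.refl _, s.2.1.elt_mem.1.symm⟩
      symm := by
        rintro s t ⟨h1, h2, h3⟩
        refine ⟨h1.symm, h2.symm, ?_⟩
        rw [h3, ← mul_assoc, h1.2, t.2.1.elt_mem.1]
      trans := by
        rintro s t w ⟨h1, h2, h3⟩ ⟨k1, k2, k3⟩
        refine ⟨h1.trans k1, h2.trans k2, ?_⟩
        rw [h3, k3, ← mul_assoc, h1.1] }

theorem lSim_comp {a b c : LG S} (s s' : LPre a b) (t t' : LPre b c) (hs : LSim s.1 s'.1)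
    (ht : LSim t.1 t'.1) :
    LSim ⟨s.1.dom, s.1.elt * t.1.elt, t.1.cod⟩ ⟨s'.1.dom, s'.1.elt * t'.1.elt, t'.1.cod⟩ := by
  refine ⟨hs.1, ht.2.1, ?_⟩
  have h : GreenL s.1.cod t.1.dom := LG.of_eq_iff.1 (s.2.2.2.trans t.2.2.1.symm)
  change s.1.elt * t.1.elt = s.1.dom.val * (s'.1.elt * t'.1.elt)
  have h2 : s.1.elt * t.1.dom.val = s.1.elt := by
    rw [← s.2.1.elt_mem.2, mul_assoc, h.1]
  rw [ht.2.2, ← mul_assoc, h2, hs.2.2, mul_assoc]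

/-- The category `L_G`. Composition is diagrammatic: `r(e, u, f) ≫ r(f, v, g) = r(e, u v, g)`. -/
noncomputable instance : SmallCategory (LG S) where
  Hom a b := Quotient (lSimSetoid a b)
  id a := Quotient.mk (lSimSetoid a a)
    ⟨⟨a.out, a.out.val, a.out⟩, LFree.gen _ (Or.inl ⟨rfl, a.out.idem⟩),
      Quotient.out_eq a, Quotient.out_eq a⟩
  comp {a b c} := Quotient.map₂ (sa := lSimSetoid a b) (sb := lSimSetoid b c)
    (sc := lSimSetoid a c)
    (fun s t => ⟨⟨s.1.dom, s.1.elt * t.1.elt, t.1.cod⟩,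
      LFree.comp _ _ s.2.1 t.2.1 (LG.of_eq_iff.1 (s.2.2.2.trans t.2.2.1.symm)),
      s.2.2.1, t.2.2.2⟩)
    (fun s s' hs t t' ht => lSim_comp s s' t t' hs ht)
  id_comp {a b} f := by
    induction f using Quotient.inductionOn with | _ s => ?_
    refine Quotient.sound (s := lSimSetoid a b) ⟨?_, GreenL.refl _, rfl⟩
    exact LG.of_eq_iff.1 ((Quotient.out_eq a).trans s.2.2.1.symm)
  comp_id {a b} f := by
    induction f using Quotient.inductionOn with | _ s => ?_
    have h : GreenL s.1.cod b.out := LG.of_eq_iff.1 (s.2.2.2.trans (Quotient.out_eq b).symm)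
    refine Quotient.sound (s := lSimSetoid a b) ⟨GreenL.refl _, h.symm, ?_⟩
    change s.1.elt * b.out.val = s.1.dom.val * s.1.elt
    rw [s.2.1.elt_mem.1, ← s.2.1.elt_mem.2, mul_assoc, h.1]
  assoc {a b c d} f g h := by
    induction f using Quotient.inductionOn with | _ s => ?_
    induction g using Quotient.inductionOn with | _ t => ?_
    induction h using Quotient.inductionOn with | _ w => ?_
    refine congrArg (Quotient.mk (lSimSetoid a d)) (Subtype.ext ?_)
    exact congrArg (fun z => Triple.mk s.1.dom z w.1.cod) (mul_assoc _ _ _)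

/-- Inclusions of `L_G`: the classes of the morphisms of `P_L`. -/
def LG.IsIncl {a b : LG S} (φ : a ⟶ b) : Prop :=
  ∃ t : LPre a b, IsPL t.1 ∧ Quotient.mk (lSimSetoid a b) t = φ

variable [IsRegularSemigroup S]

/-- Every `u ∈ e S f` gives a generated morphism `r(e, u, f) = r(e, g, g) r(g, u, h) r(h, h, f)`. -/
theorem lFree_of_mem (e : Idem S) (u : S) (f : Idem S) (h1 : e.val * u = u) (h2 : u * f.val = u) :
    LFree ⟨e, u, f⟩ := by
  obtain ⟨v, hv1, hv2⟩ := IsRegularSemigroup.exists_inverse u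
  have i1 : (u * v * e.val) * (u * v * e.val) = u * v * e.val := by
    rw [show (u * v * e.val) * (u * v * e.val) = u * v * (e.val * u) * v * e.val by
      simp only [mul_assoc], h1, hv1]
  have i2 : v * u * (v * u) = v * u := by rw [← mul_assoc, hv2]
  let g : Idem S := ⟨u * v * e.val, i1⟩
  let h : Idem S := ⟨v * u, i2⟩
  have gu : g.val * u = u := by
    change u * v * e.val * u = u
    rw [mul_assoc, h1, hv1]
  have uh : u * h.val = u := by
    change u * (v * u) = u
    rw [← mul_assoc, hv1]
  have a1 : LFree ⟨e, g.val, g⟩ := by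
    refine LFree.gen _ (Or.inr (Or.inl ⟨g, rfl, GreenL.refl _, ?_, ?_⟩))
    · change u * v * e.val * e.val = _
      rw [mul_assoc, e.idem]
    · change e.val * (u * v * e.val) = u * v * e.val
      rw [← mul_assoc, ← mul_assoc, h1]
  have a2 : LFree ⟨g, u, h⟩ := by
    refine LFree.gen _ (Or.inr (Or.inr ⟨⟨u, v * e.val, ⟨?_, ?_⟩, ?_, ?_⟩, rfl⟩))
    · rw [mul_assoc, mul_assoc, h1, ← mul_assoc, hv1]
    · rw [mul_assoc v, h1, ← mul_assoc, hv2]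
    · exact (mul_assoc _ _ _).symm
    · rw [mul_assoc, h1]
  have a3 : LFree ⟨h, h.val, f⟩ := by
    refine LFree.gen _ (Or.inl ⟨rfl, ?_⟩)
    change v * u * f.val = v * u
    rw [mul_assoc, h2]
  have := LFree.comp _ _ (LFree.comp _ _ a1 a2 (GreenL.refl _)) a3 (GreenL.refl _)
  simpa only [gu, uh] using this

/-- The morphism `r(e, u, f)` of `L_G`, for `u ∈ e S f`. -/
def LG.r {a b : LG S} (e : Idem S) (u : S) (f : Idem S) (h1 : e.val * u = u) (h2 : u * f.val = u)
    (ha : LG.of e = a) (hb : LG.of f = b) : a ⟶ b :=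
  Quotient.mk (lSimSetoid a b) ⟨⟨e, u, f⟩, lFree_of_mem e u f h1 h2, ha, hb⟩

theorem LG.r_eq_iff {a b : LG S} {e : Idem S} {u : S} {f : Idem S} {h1 : e.val * u = u}
    {h2 : u * f.val = u} {ha : LG.of e = a} {hb : LG.of f = b}
    {g : Idem S} {v : S} {h : Idem S} {h3 : g.val * v = v}
    {h4 : v * h.val = v} {ha' : LG.of g = a} {hb' : LG.of h = b} :
    LG.r e u f h1 h2 ha hb = LG.r g v h h3 h4 ha' hb' ↔ u = e.val * v := by
  constructor
  · intro h
    exact (Quotient.exact (s := lSimSetoid a b) h).2.2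
  · intro h
    exact Quotient.sound (s := lSimSetoid a b) ⟨LG.of_eq_iff.1 (ha.trans ha'.symm),
      LG.of_eq_iff.1 (hb.trans hb'.symm), h⟩

theorem LG.r_comp {a b c : LG S} {e : Idem S} {u : S} {f : Idem S} {h1 : e.val * u = u}
    {h2 : u * f.val = u} {ha : LG.of e = a} {hb : LG.of f = b}
    {g : Idem S} {v : S} {h : Idem S} {h3 : g.val * v = v}
    {h4 : v * h.val = v} {hb' : LG.of g = b} {hc : LG.of h = c} :
    LG.r e u f h1 h2 ha hb ≫ LG.r g v h h3 h4 hb' hc =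
      LG.r e (u * v) h (by rw [← mul_assoc, h1]) (by rw [mul_assoc, h4]) ha hc := rfl

theorem LG.id_eq {a : LG S} (e : Idem S) (ha : LG.of e = a) :
    𝟙 a = LG.r e e.val e e.idem e.idem ha ha :=
  Quotient.sound (s := lSimSetoid a a) ⟨LG.of_eq_iff.1 ((Quotient.out_eq a).trans ha.symm),
    LG.of_eq_iff.1 ((Quotient.out_eq a).trans ha.symm),
    (LG.of_eq_iff.1 ((Quotient.out_eq a).trans ha.symm)).1.symm⟩

theorem LG.exists_r {a b : LG S} (φ : a ⟶ b) (e f : Idem S) (ha : LG.of e = a)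
    (hb : LG.of f = b) : ∃ (u : S) (h1 : e.val * u = u) (h2 : u * f.val = u),
      φ = LG.r e u f h1 h2 ha hb := by
  obtain ⟨t, rfl⟩ := Quotient.exists_rep (s := lSimSetoid a b) φ
  have k1 := LG.of_eq_iff.1 (ha.trans t.2.2.1.symm)
  have k2 := LG.of_eq_iff.1 (hb.trans t.2.2.2.symm)
  refine ⟨e.val * t.1.elt, by rw [← mul_assoc, e.idem], ?_, ?_⟩
  · rw [mul_assoc, ← t.2.1.elt_mem.2, mul_assoc t.1.elt, k2.2]
  · refine Quotient.sound (s := lSimSetoid a b) ⟨k1.symm, k2.symm, ?_⟩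
    change t.1.elt = t.1.dom.val * (e.val * t.1.elt)
    rw [← mul_assoc, k1.2, t.2.1.elt_mem.1]

theorem LG.isIncl_r_iff {a b : LG S} {e : Idem S} {u : S} {f : Idem S} {h1 : e.val * u = u}
    {h2 : u * f.val = u} {ha : LG.of e = a} {hb : LG.of f = b} :
    LG.IsIncl (LG.r e u f h1 h2 ha hb) ↔ u = e.val := by
  constructor
  · rintro ⟨t, ⟨ht, -⟩, h⟩
    have h' := Quotient.exact (s := lSimSetoid a b) h.symm
    have := h'.2.2
    change u = e.val * t.1.elt at this
    rw [this, ht]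
    exact h'.1.1
  · rintro rfl
    exact ⟨⟨⟨e, e.val, f⟩, lFree_of_mem _ _ _ h1 h2, ha, hb⟩, ⟨rfl, h2⟩, rfl⟩

instance : CategoryWithSubobjects (LG S) where
  Incl φ := LG.IsIncl φ
  id_mem a := by
    obtain ⟨e, rfl⟩ := LG.exists_rep a
    rw [LG.id_eq e rfl, LG.isIncl_r_iff]
  comp_mem {a b c} φ ψ hφ hψ := by
    obtain ⟨e, rfl⟩ := LG.exists_rep a
    obtain ⟨f, rfl⟩ := LG.exists_rep b
    obtain ⟨g, rfl⟩ := LG.exists_rep c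
    obtain ⟨u, h1, h2, rfl⟩ := LG.exists_r φ e f rfl rfl
    obtain ⟨v, h3, h4, rfl⟩ := LG.exists_r ψ f g rfl rfl
    rw [LG.isIncl_r_iff] at hφ hψ
    rw [LG.r_comp, LG.isIncl_r_iff, hψ, h2, hφ]
  unique {a b} φ ψ hφ hψ := by
    obtain ⟨e, rfl⟩ := LG.exists_rep a
    obtain ⟨f, rfl⟩ := LG.exists_rep b
    obtain ⟨u, h1, h2, rfl⟩ := LG.exists_r φ e f rfl rfl
    obtain ⟨v, h3, h4, rfl⟩ := LG.exists_r ψ e f rfl rfl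
    rw [LG.isIncl_r_iff] at hφ hψ
    rw [LG.r_eq_iff, h3, hφ, hψ]
  antisymm {a b} φ ψ hφ hψ := by
    obtain ⟨e, rfl⟩ := LG.exists_rep a
    obtain ⟨f, rfl⟩ := LG.exists_rep b
    obtain ⟨u, h1, h2, rfl⟩ := LG.exists_r φ e f rfl rfl
    obtain ⟨v, h3, h4, rfl⟩ := LG.exists_r ψ f e rfl rfl
    rw [LG.isIncl_r_iff] at hφ hψ
    rw [hφ] at h2
    rw [hψ] at h4
    exact LG.of_eq_iff.2 ⟨h2, h4⟩
  mono {a b} φ hφ := by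
    obtain ⟨e, rfl⟩ := LG.exists_rep a
    obtain ⟨f, rfl⟩ := LG.exists_rep b
    obtain ⟨u, h1, h2, rfl⟩ := LG.exists_r φ e f rfl rfl
    rw [LG.isIncl_r_iff] at hφ
    refine ⟨fun {c} ψ χ h => ?_⟩
    obtain ⟨g, rfl⟩ := LG.exists_rep c
    obtain ⟨v, h3, h4, rfl⟩ := LG.exists_r ψ g e rfl rfl
    obtain ⟨w, h5, h6, rfl⟩ := LG.exists_r χ g e rfl rfl
    rw [LG.r_comp, LG.r_comp, LG.r_eq_iff, hφ, h4, h6] at h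
    exact LG.r_eq_iff.2 h
  left_mem {a b c} φ ψ hψ h := by
    obtain ⟨e, rfl⟩ := LG.exists_rep a
    obtain ⟨f, rfl⟩ := LG.exists_rep b
    obtain ⟨g, rfl⟩ := LG.exists_rep c
    obtain ⟨u, h1, h2, rfl⟩ := LG.exists_r φ e f rfl rfl
    obtain ⟨v, h3, h4, rfl⟩ := LG.exists_r ψ f g rfl rfl
    rw [LG.r_comp, LG.isIncl_r_iff] at h
    rw [LG.isIncl_r_iff] at hψ ⊢
    rwa [hψ, h2] at h

/-- The components `r^e(ḡ) = r(g, g e, e)` of the principal cone of an idempotent `e`. -/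
noncomputable def principalComp (e : Idem S) (a : LG S) : a ⟶ LG.of e :=
  LG.r a.out (a.out.val * e.val) e (by rw [← mul_assoc, a.out.idem])
    (by rw [mul_assoc, e.idem]) (Quotient.out_eq a) rfl

theorem principalComp_eq (e g : Idem S) {a : LG S} (ha : LG.of g = a) :
    principalComp e a = LG.r g (g.val * e.val) e (by rw [← mul_assoc, g.idem])
      (by rw [mul_assoc, e.idem]) ha rfl := by
  refine LG.r_eq_iff.2 ?_
  rw [← mul_assoc, (LG.of_eq_iff.1 ((Quotient.out_eq a).trans ha.symm)).1]

theorem principalComp_self (e : Idem S) : principalComp e (LG.of e) = 𝟙 (LG.of e) := by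
  rw [principalComp_eq e e rfl, LG.id_eq e rfl, LG.r_eq_iff]

theorem isNormalCone_principalComp (e : Idem S) : IsNormalCone (principalComp e) := by
  refine ⟨fun {a b} j hj => ?_, LG.of e, ?_⟩
  · obtain ⟨f, rfl⟩ := LG.exists_rep a
    obtain ⟨g, rfl⟩ := LG.exists_rep b
    obtain ⟨u, h1, h2, rfl⟩ := LG.exists_r j f g rfl rfl
    have hj' : u = f.val := LG.isIncl_r_iff.1 hj
    rw [principalComp_eq e f rfl, principalComp_eq e g rfl, LG.r_comp, LG.r_eq_iff,
      ← mul_assoc, h2, hj', ← mul_assoc, f.idem]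
  · rw [principalComp_self]; infer_instance

/-- The principal cone `r^e`, with apex the image of `e` in `E/L`. -/
noncomputable abbrev principalCone (e : Idem S) : NormalCone (LG S) where
  apex := LG.of e
  comp := principalComp e
  isNormal := isNormalCone_principalComp e

instance : IsNormalCategory (LG S) where
  exists_factorization {a b} φ := by
    obtain ⟨e, rfl⟩ := LG.exists_rep a
    obtain ⟨f, rfl⟩ := LG.exists_rep b
    obtain ⟨u, h1, h2, rfl⟩ := LG.exists_r φ e f rfl rfl
    obtain ⟨v, hv1, hv2⟩ := IsRegularSemigroup.exists_inverse u
    have i1 : (u * v * e.val) * (u * v * e.val) = u * v * e.val := by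
      rw [show (u * v * e.val) * (u * v * e.val) = u * v * (e.val * u) * v * e.val by
        simp only [mul_assoc], h1, hv1]
    have i2 : v * u * (v * u) = v * u := by rw [← mul_assoc, hv2]
    obtain ⟨g, hg⟩ : ∃ g : Idem S, g.val = u * v * e.val := ⟨⟨_, i1⟩, rfl⟩
    obtain ⟨h, hh⟩ : ∃ h : Idem S, h.val = v * u := ⟨⟨_, i2⟩, rfl⟩
    have gu : g.val * u = u := by rw [hg, mul_assoc, h1, hv1]
    have uh : u * h.val = u := by rw [hh, ← mul_assoc, hv1]
    have eg : e.val * g.val = g.val := by rw [hg, ← mul_assoc, ← mul_assoc, h1]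
    have ge : g.val * e.val = g.val := by rw [hg, mul_assoc, e.idem]
    have hf : h.val * f.val = h.val := by rw [hh, mul_assoc, h2]
    have w1 : h.val * (v * e.val) = v * e.val := by rw [hh, ← mul_assoc, hv2]
    have w2 : v * e.val * g.val = v * e.val := by
      rw [mul_assoc, eg, hg, ← mul_assoc, ← mul_assoc, hv2]
    refine ⟨⟨LG.of g, LG.of h, LG.r e g.val g eg g.idem rfl rfl, LG.r g u h gu uh rfl rfl,
      LG.r h h.val f h.idem hf rfl rfl, ⟨LG.r g g.val e g.idem ge rfl rfl, ?_, ?_⟩, ?_, ?_, ?_⟩⟩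
    · exact LG.isIncl_r_iff.2 rfl
    · rw [LG.r_comp, LG.id_eq g rfl, LG.r_eq_iff]
    · refine ⟨LG.r h (v * e.val) g w1 w2 rfl rfl, ?_, ?_⟩
      · rw [LG.r_comp, LG.id_eq g rfl, LG.r_eq_iff, g.idem, hg, mul_assoc]
      · rw [LG.r_comp, LG.id_eq h rfl, LG.r_eq_iff, h.idem, hh, mul_assoc, h1]
    · exact LG.isIncl_r_iff.2 rfl
    · rw [LG.r_comp, LG.r_comp, LG.r_eq_iff, h1, uh, gu]
  incl_splits {a b} j hj := by
    obtain ⟨e, rfl⟩ := LG.exists_rep a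
    obtain ⟨f, rfl⟩ := LG.exists_rep b
    obtain ⟨u, h1, h2, rfl⟩ := LG.exists_r j e f rfl rfl
    obtain rfl : u = e.val := LG.isIncl_r_iff.1 hj
    refine ⟨LG.r f (f.val * e.val) e (by rw [← mul_assoc, f.idem]) (by rw [mul_assoc, e.idem])
      rfl rfl, ?_⟩
    rw [LG.r_comp, LG.id_eq e rfl, LG.r_eq_iff, ← mul_assoc, h2]
  exists_cone a := by
    obtain ⟨e, rfl⟩ := LG.exists_rep a
    exact ⟨principalComp e, isNormalCone_principalComp e, principalComp_self e⟩

end LG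

/-! ### The category `R_G` -/

section RG

variable {S : Type u} [Semigroup S]

/-- `l(e, e, f)` with `e ω^r f`: the morphisms of `P_R`. -/
def IsPR (t : Triple S) : Prop := t.elt = t.dom.val ∧ OmegaR t.dom t.cod

/-- `l(e, u, f)` with `u ∈ E(R_f) ∩ ω(e)`: the morphisms of `Q_R`. -/
def IsQR (t : Triple S) : Prop :=
  ∃ g : Idem S, g.val = t.elt ∧ GreenR g t.cod ∧ OmegaL g t.dom ∧ OmegaR g t.dom

/-- `l(e, x', f)` for a morphism `(x, x')` from `e` to `f` of `G(S)`: the morphisms of `G_R`. -/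
def IsGR (t : Triple S) : Prop := ∃ p : t.dom ⟶ t.cod, p.x' = t.elt

/-- The morphisms generated by the quiver `P_R ∪ Q_R ∪ G_R` under the composition
`l(e, u, f) l(g, v, h) = l(e, v u, h)`, defined when `f` and `g` are `R`-related. (The identities
`l(e, e, e)` belong to `P_R`.) -/
inductive RFree : Triple S → Prop
  | gen (t : Triple S) : IsPR t ∨ IsQR t ∨ IsGR t → RFree t
  | comp (s t : Triple S) : RFree s → RFree t → GreenR s.cod t.dom →
      RFree ⟨s.dom, t.elt * s.elt, t.cod⟩

/-- `l(e, u, f) ∼ l(g, v, h)` if and only if `e R g`, `f R h` and `u = v e`. -/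
def RSim (s t : Triple S) : Prop :=
  GreenR s.dom t.dom ∧ GreenR s.cod t.cod ∧ s.elt = t.elt * s.dom.val

theorem RFree.elt_mem {t : Triple S} (h : RFree t) :
    t.cod.val * t.elt = t.elt ∧ t.elt * t.dom.val = t.elt := by
  induction h with
  | gen t h =>
    rcases h with ⟨h1, h2⟩ | ⟨g, hg, h1, h2, h3⟩ | ⟨p, hp⟩
    · rw [h1]; exact ⟨h2, t.dom.idem⟩
    · rw [← hg]; exact ⟨h1.1, h2⟩
    · rw [← hp, ← p.dom_eq, ← p.cod_eq, ← mul_assoc]; exact ⟨p.inverse.2, p.inverse.2⟩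
  | comp s t hs ht hst ihs iht =>
    exact ⟨by rw [← mul_assoc, iht.1], by rw [mul_assoc, ihs.2]⟩

variable (S) in
/-- The relation `R` as an equivalence relation on `E`. -/
def rSetoid : Setoid (Idem S) := ⟨GreenR, GreenR.refl, GreenR.symm, GreenR.trans⟩

variable (S) in
/-- The object set `E/R` of the category `R_G`. -/
def RG : Type u := Quotient (rSetoid S)

/-- The image of `e` in `E/R`. -/
def RG.of (e : Idem S) : RG S := Quotient.mk (rSetoid S) e

theorem RG.of_eq_iff {e f : Idem S} : RG.of e = RG.of f ↔ GreenR e f :=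
  ⟨fun h => Quotient.exact (s := rSetoid S) h, fun h => Quotient.sound (s := rSetoid S) h⟩

theorem RG.exists_rep (a : RG S) : ∃ e : Idem S, RG.of e = a :=
  Quotient.exists_rep (s := rSetoid S) a

/-- Generated morphisms from `a` to `b`. -/
def RPre (a b : RG S) : Type u :=
  {t : Triple S // RFree t ∧ RG.of t.dom = a ∧ RG.of t.cod = b}

/-- The relation `∼` as an equivalence relation. -/
def rSimSetoid (a b : RG S) : Setoid (RPre a b) where
  r s t := RSim s.1 t.1
  iseqv :=
    { refl := fun s => ⟨GreenR.refl _, GreenR.refl _, s.2.1.elt_mem.2.symm⟩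
      symm := by
        rintro s t ⟨h1, h2, h3⟩
        refine ⟨h1.symm, h2.symm, ?_⟩
        rw [h3, mul_assoc, h1.2, t.2.1.elt_mem.2]
      trans := by
        rintro s t w ⟨h1, h2, h3⟩ ⟨k1, k2, k3⟩
        refine ⟨h1.trans k1, h2.trans k2, ?_⟩
        rw [h3, k3, mul_assoc, h1.1] }

theorem rSim_comp {a b c : RG S} (s s' : RPre a b) (t t' : RPre b c) (hs : RSim s.1 s'.1)
    (ht : RSim t.1 t'.1) :
    RSim ⟨s.1.dom, t.1.elt * s.1.elt, t.1.cod⟩ ⟨s'.1.dom, t'.1.elt * s'.1.elt, t'.1.cod⟩ := by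
  refine ⟨hs.1, ht.2.1, ?_⟩
  have h : GreenR s.1.cod t.1.dom := RG.of_eq_iff.1 (s.2.2.2.trans t.2.2.1.symm)
  change t.1.elt * s.1.elt = t'.1.elt * s'.1.elt * s.1.dom.val
  have h2 : t.1.dom.val * s.1.elt = s.1.elt := by
    rw [← s.2.1.elt_mem.1, ← mul_assoc, h.1]
  rw [ht.2.2, mul_assoc, h2, hs.2.2, mul_assoc]

/-- The category `R_G`. Composition is diagrammatic: `l(e, u, f) ≫ l(f, v, g) = l(e, v u, g)`. -/
noncomputable instance : SmallCategory (RG S) where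
  Hom a b := Quotient (rSimSetoid a b)
  id a := Quotient.mk (rSimSetoid a a)
    ⟨⟨a.out, a.out.val, a.out⟩, RFree.gen _ (Or.inl ⟨rfl, a.out.idem⟩),
      Quotient.out_eq a, Quotient.out_eq a⟩
  comp {a b c} := Quotient.map₂ (sa := rSimSetoid a b) (sb := rSimSetoid b c)
    (sc := rSimSetoid a c)
    (fun s t => ⟨⟨s.1.dom, t.1.elt * s.1.elt, t.1.cod⟩,
      RFree.comp _ _ s.2.1 t.2.1 (RG.of_eq_iff.1 (s.2.2.2.trans t.2.2.1.symm)),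
      s.2.2.1, t.2.2.2⟩)
    (fun s s' hs t t' ht => rSim_comp s s' t t' hs ht)
  id_comp {a b} f := by
    induction f using Quotient.inductionOn with | _ s => ?_
    refine Quotient.sound (s := rSimSetoid a b) ⟨?_, GreenR.refl _, rfl⟩
    exact RG.of_eq_iff.1 ((Quotient.out_eq a).trans s.2.2.1.symm)
  comp_id {a b} f := by
    induction f using Quotient.inductionOn with | _ s => ?_
    have h : GreenR s.1.cod b.out := RG.of_eq_iff.1 (s.2.2.2.trans (Quotient.out_eq b).symm)
    refine Quotient.sound (s := rSimSetoid a b) ⟨GreenR.refl _, h.symm, ?_⟩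
    change b.out.val * s.1.elt = s.1.elt * s.1.dom.val
    rw [s.2.1.elt_mem.2, ← s.2.1.elt_mem.1, ← mul_assoc, h.1]
  assoc {a b c d} f g h := by
    induction f using Quotient.inductionOn with | _ s => ?_
    induction g using Quotient.inductionOn with | _ t => ?_
    induction h using Quotient.inductionOn with | _ w => ?_
    refine congrArg (Quotient.mk (rSimSetoid a d)) (Subtype.ext ?_)
    exact congrArg (fun z => Triple.mk s.1.dom z w.1.cod) (mul_assoc _ _ _).symm

/-- Inclusions of `R_G`: the classes of the morphisms of `P_R`. -/
def RG.IsIncl {a b : RG S} (φ : a ⟶ b) : Prop :=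
  ∃ t : RPre a b, IsPR t.1 ∧ Quotient.mk (rSimSetoid a b) t = φ

variable [IsRegularSemigroup S]

/-- Every `u ∈ f S e` gives a generated morphism `l(e, u, f) = l(e, g, g) l(g, u, h) l(h, h, f)`. -/
theorem rFree_of_mem (e : Idem S) (u : S) (f : Idem S) (h1 : f.val * u = u) (h2 : u * e.val = u) :
    RFree ⟨e, u, f⟩ := by
  obtain ⟨v, hv1, hv2⟩ := IsRegularSemigroup.exists_inverse u
  have i1 : (e.val * (v * u)) * (e.val * (v * u)) = e.val * (v * u) := by
    rw [show (e.val * (v * u)) * (e.val * (v * u)) = e.val * (v * (u * e.val * v * u)) by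
      simp only [mul_assoc], h2, hv1]
  have i2 : u * v * (u * v) = u * v := by rw [← mul_assoc, hv1]
  let g : Idem S := ⟨e.val * (v * u), i1⟩
  let h : Idem S := ⟨u * v, i2⟩
  have ug : u * g.val = u := by
    change u * (e.val * (v * u)) = u
    rw [← mul_assoc, h2, ← mul_assoc, hv1]
  have hu : h.val * u = u := hv1
  have a1 : RFree ⟨e, g.val, g⟩ := by
    refine RFree.gen _ (Or.inr (Or.inl ⟨g, rfl, GreenR.refl _, ?_, ?_⟩))
    · change e.val * (v * u) * e.val = e.val * (v * u)
      rw [mul_assoc, mul_assoc, h2]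
    · change e.val * (e.val * (v * u)) = e.val * (v * u)
      rw [← mul_assoc, e.idem]
  have a2 : RFree ⟨g, u, h⟩ := by
    refine RFree.gen _ (Or.inr (Or.inr ⟨⟨e.val * v, u, ⟨?_, ?_⟩, ?_, ?_⟩, rfl⟩))
    · rw [mul_assoc, mul_assoc, ← mul_assoc u, h2, ← mul_assoc v, hv2]
    · rw [← mul_assoc, h2, hv1]
    · exact mul_assoc _ _ _
    · rw [← mul_assoc, h2]
  have a3 : RFree ⟨h, h.val, f⟩ := by
    refine RFree.gen _ (Or.inl ⟨rfl, ?_⟩)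
    change f.val * (u * v) = u * v
    rw [← mul_assoc, h1]
  have := RFree.comp _ _ (RFree.comp _ _ a1 a2 (GreenR.refl _)) a3 (GreenR.refl _)
  simpa only [ug, hu] using this

/-- The morphism `l(e, u, f)` of `R_G`, for `u ∈ f S e`. -/
def RG.l {a b : RG S} (e : Idem S) (u : S) (f : Idem S) (h1 : f.val * u = u) (h2 : u * e.val = u)
    (ha : RG.of e = a) (hb : RG.of f = b) : a ⟶ b :=
  Quotient.mk (rSimSetoid a b) ⟨⟨e, u, f⟩, rFree_of_mem e u f h1 h2, ha, hb⟩

theorem RG.l_eq_iff {a b : RG S} {e : Idem S} {u : S} {f : Idem S} {h1 : f.val * u = u}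
    {h2 : u * e.val = u} {ha : RG.of e = a} {hb : RG.of f = b}
    {g : Idem S} {v : S} {h : Idem S} {h3 : h.val * v = v}
    {h4 : v * g.val = v} {ha' : RG.of g = a} {hb' : RG.of h = b} :
    RG.l e u f h1 h2 ha hb = RG.l g v h h3 h4 ha' hb' ↔ u = v * e.val := by
  constructor
  · intro h
    exact (Quotient.exact (s := rSimSetoid a b) h).2.2
  · intro h
    exact Quotient.sound (s := rSimSetoid a b) ⟨RG.of_eq_iff.1 (ha.trans ha'.symm),
      RG.of_eq_iff.1 (hb.trans hb'.symm), h⟩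

theorem RG.l_comp {a b c : RG S} {e : Idem S} {u : S} {f : Idem S} {h1 : f.val * u = u}
    {h2 : u * e.val = u} {ha : RG.of e = a} {hb : RG.of f = b}
    {g : Idem S} {v : S} {h : Idem S} {h3 : h.val * v = v}
    {h4 : v * g.val = v} {hb' : RG.of g = b} {hc : RG.of h = c} :
    RG.l e u f h1 h2 ha hb ≫ RG.l g v h h3 h4 hb' hc =
      RG.l e (v * u) h (by rw [← mul_assoc, h3]) (by rw [mul_assoc, h2]) ha hc := rfl

theorem RG.id_eq {a : RG S} (e : Idem S) (ha : RG.of e = a) :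
    𝟙 a = RG.l e e.val e e.idem e.idem ha ha :=
  Quotient.sound (s := rSimSetoid a a) ⟨RG.of_eq_iff.1 ((Quotient.out_eq a).trans ha.symm),
    RG.of_eq_iff.1 ((Quotient.out_eq a).trans ha.symm),
    (RG.of_eq_iff.1 ((Quotient.out_eq a).trans ha.symm)).1.symm⟩

theorem RG.exists_l {a b : RG S} (φ : a ⟶ b) (e f : Idem S) (ha : RG.of e = a)
    (hb : RG.of f = b) : ∃ (u : S) (h1 : f.val * u = u) (h2 : u * e.val = u),
      φ = RG.l e u f h1 h2 ha hb := by
  obtain ⟨t, rfl⟩ := Quotient.exists_rep (s := rSimSetoid a b) φ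
  have k1 := RG.of_eq_iff.1 (ha.trans t.2.2.1.symm)
  have k2 := RG.of_eq_iff.1 (hb.trans t.2.2.2.symm)
  refine ⟨t.1.elt * e.val, ?_, by rw [mul_assoc, e.idem], ?_⟩
  · rw [← mul_assoc, ← t.2.1.elt_mem.1, ← mul_assoc f.val, k2.2]
  · refine Quotient.sound (s := rSimSetoid a b) ⟨k1.symm, k2.symm, ?_⟩
    change t.1.elt = t.1.elt * e.val * t.1.dom.val
    rw [mul_assoc, k1.2, t.2.1.elt_mem.2]

theorem RG.isIncl_l_iff {a b : RG S} {e : Idem S} {u : S} {f : Idem S} {h1 : f.val * u = u}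
    {h2 : u * e.val = u} {ha : RG.of e = a} {hb : RG.of f = b} :
    RG.IsIncl (RG.l e u f h1 h2 ha hb) ↔ u = e.val := by
  constructor
  · rintro ⟨t, ⟨ht, -⟩, h⟩
    have h' := Quotient.exact (s := rSimSetoid a b) h.symm
    have := h'.2.2
    change u = t.1.elt * e.val at this
    rw [this, ht]
    exact h'.1.1
  · rintro rfl
    exact ⟨⟨⟨e, e.val, f⟩, rFree_of_mem _ _ _ h1 h2, ha, hb⟩, ⟨rfl, h1⟩, rfl⟩

instance : CategoryWithSubobjects (RG S) where
  Incl φ := RG.IsIncl φ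
  id_mem a := by
    obtain ⟨e, rfl⟩ := RG.exists_rep a
    rw [RG.id_eq e rfl, RG.isIncl_l_iff]
  comp_mem {a b c} φ ψ hφ hψ := by
    obtain ⟨e, rfl⟩ := RG.exists_rep a
    obtain ⟨f, rfl⟩ := RG.exists_rep b
    obtain ⟨g, rfl⟩ := RG.exists_rep c
    obtain ⟨u, h1, h2, rfl⟩ := RG.exists_l φ e f rfl rfl
    obtain ⟨v, h3, h4, rfl⟩ := RG.exists_l ψ f g rfl rfl
    rw [RG.isIncl_l_iff] at hφ hψ
    rw [RG.l_comp, RG.isIncl_l_iff, hψ, h1, hφ]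
  unique {a b} φ ψ hφ hψ := by
    obtain ⟨e, rfl⟩ := RG.exists_rep a
    obtain ⟨f, rfl⟩ := RG.exists_rep b
    obtain ⟨u, h1, h2, rfl⟩ := RG.exists_l φ e f rfl rfl
    obtain ⟨v, h3, h4, rfl⟩ := RG.exists_l ψ e f rfl rfl
    rw [RG.isIncl_l_iff] at hφ hψ
    rw [RG.l_eq_iff, h4, hφ, hψ]
  antisymm {a b} φ ψ hφ hψ := by
    obtain ⟨e, rfl⟩ := RG.exists_rep a
    obtain ⟨f, rfl⟩ := RG.exists_rep b
    obtain ⟨u, h1, h2, rfl⟩ := RG.exists_l φ e f rfl rfl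
    obtain ⟨v, h3, h4, rfl⟩ := RG.exists_l ψ f e rfl rfl
    rw [RG.isIncl_l_iff] at hφ hψ
    rw [hφ] at h1
    rw [hψ] at h3
    exact RG.of_eq_iff.2 ⟨h1, h3⟩
  mono {a b} φ hφ := by
    obtain ⟨e, rfl⟩ := RG.exists_rep a
    obtain ⟨f, rfl⟩ := RG.exists_rep b
    obtain ⟨u, h1, h2, rfl⟩ := RG.exists_l φ e f rfl rfl
    rw [RG.isIncl_l_iff] at hφ
    refine ⟨fun {c} ψ χ h => ?_⟩
    obtain ⟨g, rfl⟩ := RG.exists_rep c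
    obtain ⟨v, h3, h4, rfl⟩ := RG.exists_l ψ g e rfl rfl
    obtain ⟨w, h5, h6, rfl⟩ := RG.exists_l χ g e rfl rfl
    rw [RG.l_comp, RG.l_comp, RG.l_eq_iff, hφ, h3, h5] at h
    exact RG.l_eq_iff.2 h
  left_mem {a b c} φ ψ hψ h := by
    obtain ⟨e, rfl⟩ := RG.exists_rep a
    obtain ⟨f, rfl⟩ := RG.exists_rep b
    obtain ⟨g, rfl⟩ := RG.exists_rep c
    obtain ⟨u, h1, h2, rfl⟩ := RG.exists_l φ e f rfl rfl
    obtain ⟨v, h3, h4, rfl⟩ := RG.exists_l ψ f g rfl rfl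
    rw [RG.l_comp, RG.isIncl_l_iff] at h
    rw [RG.isIncl_l_iff] at hψ ⊢
    rwa [hψ, h1] at h

end RG

/-! ### The functor `Γ_G` -/

section Gamma

variable {S : Type u} [Semigroup S] [IsRegularSemigroup S]

theorem principalCone_comp (e g : Idem S) :
    (principalCone e).comp (LG.of g) = LG.r g (g.val * e.val) e
      (by rw [← mul_assoc, g.idem]) (by rw [mul_assoc, e.idem]) rfl rfl :=
  principalComp_eq e g rfl

theorem Hobj_principalCone_eq {e f : Idem S} (h : GreenR e f) :
    Hobj (principalCone e) = Hobj (principalCone f) := by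
  refine Hobj_eq _ _ (LG.r e (e.val * f.val) f (by rw [← mul_assoc, e.idem])
    (by rw [mul_assoc, f.idem]) rfl rfl) (LG.r f (f.val * e.val) e
    (by rw [← mul_assoc, f.idem]) (by rw [mul_assoc, e.idem]) rfl rfl) ?_ ?_
  · intro a
    obtain ⟨g, rfl⟩ := LG.exists_rep a
    rw [principalCone_comp, principalCone_comp]
    change LG.r _ _ _ _ _ _ _ ≫ LG.r _ _ _ _ _ _ _ = _
    rw [LG.r_comp, LG.r_eq_iff, h.2, mul_assoc, h.2]
    rw [← mul_assoc, g.idem]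
  · intro a
    obtain ⟨g, rfl⟩ := LG.exists_rep a
    rw [principalCone_comp, principalCone_comp]
    change LG.r _ _ _ _ _ _ _ ≫ LG.r _ _ _ _ _ _ _ = _
    rw [LG.r_comp, LG.r_eq_iff, h.1, mul_assoc, h.1]
    rw [← mul_assoc, g.idem]

/-- The object map of `Γ_G`: the image of `e` in `E/R` is mapped to `H(r^e; -)`. -/
noncomputable def gammaObj (a : RG S) : NormalDual (LG S) :=
  Quotient.lift (s := rSetoid S) (fun e => Hobj (principalCone e))
    (fun _ _ h => Hobj_principalCone_eq h) a

theorem gammaObj_eq {a : RG S} (e : Idem S) (h : RG.of e = a) :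
    gammaObj a = Hobj (principalCone e) := by
  subst h
  rfl

/-- `Γ_G(l(e, u, f)) = η_{r^e} L_G(r(f, u, e), -) η_{r^f}⁻¹`, as a morphism from `H(r^e; -)` to
`H(r^f; -)`. -/
noncomputable def gammaTriple (t : Triple S) (ht : RFree t) :
    Hobj (principalCone t.dom) ⟶ Hobj (principalCone t.cod) :=
  Hmap (principalCone t.dom) (principalCone t.cod)
    (LG.r t.cod t.elt t.dom ht.elt_mem.1 ht.elt_mem.2 rfl rfl)

theorem gammaTriple_app (t : Triple S) (ht : RFree t) (e : Idem S)
    {c : LG S} (g : LG.of e ⟶ c) (α : Hset (principalCone t.dom) c)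
    (hα : (α : NormalCone (LG S)) = (principalCone e).starEpi g) (f : Idem S)
    (hf : GreenR f t.cod) (v : S) (h1 : f.val * v = v) (h2 : v * e.val = v)
    (hv : v = t.elt * e.val) :
    (NormalDual.app (gammaTriple t ht) c α : NormalCone (LG S)) =
      (principalCone f).starEpi (LG.r f v e h1 h2 rfl rfl ≫ g) := by
  obtain ⟨_, g', rfl⟩ := α
  refine (Hmap_app (principalCone t.dom) (principalCone t.cod) _ g' _).trans ?_
  have hg := (starEpi_eq_iff _ _ _ _).1 hα (LG.of t.dom)
  have e1 : (principalCone t.dom).comp (LG.of t.dom) = 𝟙 (LG.of t.dom) := principalComp_self _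
  rw [e1] at hg
  have hg' : g' = (principalCone e).comp (LG.of t.dom) ≫ g := by
    rw [← hg]; exact (Category.id_comp _).symm
  rw [principalCone_comp] at hg'
  rw [starEpi_eq_iff]
  intro k
  obtain ⟨x, rfl⟩ := LG.exists_rep k
  rw [hg', principalCone_comp, principalCone_comp]
  change LG.r _ _ _ _ _ _ _ ≫ LG.r _ _ _ _ _ _ _ ≫ LG.r _ _ _ _ _ _ _ ≫ g =
    LG.r _ _ _ _ _ _ _ ≫ LG.r _ _ _ _ _ _ _ ≫ g
  simp only [← Category.assoc, LG.r_comp]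
  congr 1
  rw [LG.r_eq_iff]
  have e2 : f.val * t.elt = t.elt := by
    rw [← ht.elt_mem.1, ← mul_assoc, hf.2]
  have e3 : t.elt * (t.dom.val * e.val) = t.elt * e.val := by
    rw [← mul_assoc, ht.elt_mem.2]
  simp only [hv, mul_assoc]
  rw [e3, ← mul_assoc t.cod.val, ht.elt_mem.1, ← mul_assoc f.val, e2, ← mul_assoc x.val x.val,
    x.idem]

theorem gammaTriple_congr {a b : RG S} (s t : RPre a b) (h : RSim s.1 t.1) :
    eqToHom (gammaObj_eq s.1.dom s.2.2.1) ≫ gammaTriple s.1 s.2.1 ≫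
        eqToHom (gammaObj_eq s.1.cod s.2.2.2).symm =
      eqToHom (gammaObj_eq t.1.dom t.2.2.1) ≫ gammaTriple t.1 t.2.1 ≫
        eqToHom (gammaObj_eq t.1.cod t.2.2.2).symm := by
  obtain ⟨s, hs, rfl, rfl⟩ := s
  obtain ⟨t, ht, ht1, ht2⟩ := t
  refine NormalDual.hom_ext' fun c α => ?_
  rw [NormalDual.app_comp, NormalDual.app_comp, NormalDual.app_comp, NormalDual.app_comp,
    NormalDual.app_eqToHom, NormalDual.app_eqToHom]
  have e1 := NormalDual.app_eqToHom (gammaObj_eq t.dom ht1) c α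
  have e2 := NormalDual.app_eqToHom (gammaObj_eq s.dom rfl) c α
  obtain ⟨g, hg⟩ : ∃ g : LG.of s.dom ⟶ c, (principalCone s.dom).starEpi g = α := α.2
  have k1 : s.cod.val * s.elt = s.elt := hs.elt_mem.1
  have k2 : s.elt * s.dom.val = s.elt := hs.elt_mem.2
  refine (gammaTriple_app s hs s.dom g _ (e2.trans hg.symm) s.cod (GreenR.refl _) s.elt k1 k2
    k2.symm).trans ?_
  exact (gammaTriple_app t ht s.dom g _ (e1.trans hg.symm) s.cod h.2.1 s.elt k1 k2 h.2.2).symm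

/-- The morphism map of `Γ_G`. -/
noncomputable def gammaMap {a b : RG S} (φ : a ⟶ b) : gammaObj a ⟶ gammaObj b :=
  Quotient.lift (s := rSimSetoid a b)
    (fun t : RPre a b => eqToHom (gammaObj_eq t.1.dom t.2.2.1) ≫ gammaTriple t.1 t.2.1 ≫
      eqToHom (gammaObj_eq t.1.cod t.2.2.2).symm)
    gammaTriple_congr φ

theorem gammaMap_l (e : Idem S) (u : S) (f : Idem S) (h1 : f.val * u = u) (h2 : u * e.val = u) :
    gammaMap (RG.l e u f h1 h2 rfl rfl) =
      Hmap (principalCone e) (principalCone f) (LG.r f u e h1 h2 rfl rfl) := by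
  change 𝟙 _ ≫ Hmap (principalCone e) (principalCone f) _ ≫ 𝟙 _ = _
  rw [Category.id_comp, Category.comp_id]

/-- The functor `Γ_G : R_G ⥤ N*L_G`. -/
noncomputable def gammaG (S : Type u) [Semigroup S] [IsRegularSemigroup S] :
    RG S ⥤ NormalDual (LG S) where
  obj a := gammaObj a
  map φ := gammaMap φ
  map_id a := by
    obtain ⟨e, rfl⟩ := RG.exists_rep a
    rw [RG.id_eq e rfl, gammaMap_l, ← LG.id_eq e rfl]
    refine NormalDual.hom_ext' fun c α => ?_
    obtain ⟨_, g, rfl⟩ := α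
    refine (Hmap_app _ _ _ g _).trans ?_
    rw [Category.id_comp]
    rfl
  map_comp {a b c} φ ψ := by
    obtain ⟨e, rfl⟩ := RG.exists_rep a
    obtain ⟨f, rfl⟩ := RG.exists_rep b
    obtain ⟨g, rfl⟩ := RG.exists_rep c
    obtain ⟨u, h1, h2, rfl⟩ := RG.exists_l φ e f rfl rfl
    obtain ⟨v, h3, h4, rfl⟩ := RG.exists_l ψ f g rfl rfl
    rw [RG.l_comp, gammaMap_l, gammaMap_l, gammaMap_l, ← LG.r_comp (h1 := h3) (h2 := h4)
      (h3 := h1) (h4 := h2) (hb := rfl) (hb' := rfl)]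
    refine NormalDual.hom_ext' fun c α => ?_
    obtain ⟨_, k, rfl⟩ := α
    refine (Hmap_app _ _ _ k _).trans ?_
    change _ = (NormalDual.app (Hmap (principalCone f) (principalCone g)
      (LG.r g v f h3 h4 rfl rfl)) c (NormalDual.app (Hmap (principalCone e) (principalCone f)
        (LG.r f u e h1 h2 rfl rfl)) c ⟨(principalCone e).starEpi k, k, rfl⟩) :
          NormalCone (LG S))
    have e1 : NormalDual.app (Hmap (principalCone e) (principalCone f)
        (LG.r f u e h1 h2 rfl rfl)) c ⟨(principalCone e).starEpi k, k, rfl⟩ =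
        ⟨(principalCone f).starEpi (LG.r f u e h1 h2 rfl rfl ≫ k), _, rfl⟩ :=
      Subtype.ext (Hmap_app _ _ _ k _)
    refine Eq.trans ?_ (congrArg (fun z => (NormalDual.app (Hmap (principalCone f)
      (principalCone g) (LG.r g v f h3 h4 rfl rfl)) c z : NormalCone (LG S))) e1.symm)
    refine Eq.trans ?_ (Hmap_app _ _ _ _ _).symm
    rw [Category.assoc]

end Gamma

end CrossConn

/-!
By Yoneda, the morphisms `H(γ; -) ⟶ H(δ; -)` of the normal dual are the morphisms
`r : c_δ ⟶ c_γ` of `C`, and such a morphism is an inclusion exactly when `δ(k) r = γ(k)` for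
all `k`. Under this correspondence a factorization `r = q v j` in `C` gives one in the normal dual,
and left multiplication by an idempotent normal cone `ε`, in the semigroup of normal cones, is a
normal cone of `N*C` with apex `H(ε; -)`; so `N*C` is normal. Yoneda also makes `Γ_G` fully
faithful, since `l(e, u, f)` and `r(f, u, e)` are both indexed by `u ∈ f S e`.

A fully faithful functor that preserves inclusions is injective on ideals, and if moreover it lifts
subobjects, then normality descends along it. Hence only the lifting of subobjects is left: an
`H`-functor contained in `H(r^h; -)` comes from a split epimorphism `r(h, w, f)` with section
`r(f, v, h)`, and it is `H(r^e; -)` for the idempotent `e = w v`.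
-/

namespace CrossConn

open CategoryWithSubobjects

section LocalIsomorphism

variable {C D : Type u} [SmallCategory C] [CategoryWithSubobjects C]
  [SmallCategory D] [CategoryWithSubobjects D] {F : C ⥤ D}

theorem IsSub.antisymm {a b : C} (hab : IsSub a b) (hba : IsSub b a) : a = b := by
  obtain ⟨i, hi⟩ := hab
  obtain ⟨j, hj⟩ := hba
  exact CategoryWithSubobjects.antisymm i j hi hj

/-- `F` lifts subobjects if every subobject of `F(c)` is, on the nose, the image of a subobject
of `c`. Together with full faithfulness this makes `F` an isomorphism on ideals. -/
def LiftsSubobjects (F : C ⥤ D) : Prop :=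
  ∀ (c : C) (X : D), IsSub X (F.obj c) → ∃ a : C, IsSub a c ∧ F.obj a = X

variable [F.Full] [F.Faithful]

theorem InclusionPreserving.isSub_of_isSub_obj (hF : InclusionPreserving F) {a b c : C}
    (hac : IsSub a c) (hbc : IsSub b c) (hab : IsSub (F.obj a) (F.obj b)) : IsSub a b := by
  obtain ⟨i, hi⟩ := hac
  obtain ⟨j, hj⟩ := hbc
  obtain ⟨k, hk⟩ := hab
  obtain ⟨l, rfl⟩ := F.map_surjective k
  have hlj : l ≫ j = i := F.map_injective <| by
    rw [F.map_comp]
    exact unique _ _ (comp_mem _ _ hk (hF j hj)) (hF i hi)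
  exact ⟨l, left_mem l j hj (hlj ▸ hi)⟩

theorem InclusionPreserving.eq_of_obj_eq (hF : InclusionPreserving F) {a b c : C}
    (hac : IsSub a c) (hbc : IsSub b c) (h : F.obj a = F.obj b) : a = b :=
  (hF.isSub_of_isSub_obj hac hbc (h ▸ ⟨𝟙 _, id_mem _⟩)).antisymm
    (hF.isSub_of_isSub_obj hbc hac (h ▸ ⟨𝟙 _, id_mem _⟩))

theorem InclusionPreserving.isCategoryIso_restrictIdeal (hF : InclusionPreserving F)
    (hsub : LiftsSubobjects F) (c : C) : IsCategoryIso (restrictIdeal F hF c) where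
  obj_bijective := by
    refine ⟨fun a b h => ?_, fun ⟨X, hX⟩ => ?_⟩
    · exact ObjectProperty.FullSubcategory.ext (hF.eq_of_obj_eq a.property b.property
        (congrArg ObjectProperty.FullSubcategory.obj h))
    · obtain ⟨a, ha, rfl⟩ := hsub c X hX
      exact ⟨⟨a, ha⟩, rfl⟩
  full := by
    unfold restrictIdeal
    infer_instance
  faithful := by
    unfold restrictIdeal
    infer_instance

theorem InclusionPreserving.nonempty_normalFactorization (hF : InclusionPreserving F)
    (hsub : LiftsSubobjects F) {c d : C} (f : c ⟶ d) (N : NormalFactorization (F.map f)) :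
    Nonempty (NormalFactorization f) := by
  obtain ⟨X, Y, q, v, j, ⟨i, hi, hiq⟩, hv, hj, fac⟩ := N
  obtain ⟨c', ⟨i', hi'⟩, rfl⟩ := hsub c X ⟨i, hi⟩
  obtain ⟨d', ⟨j', hj'⟩, rfl⟩ := hsub d Y ⟨j, hj⟩
  obtain rfl := unique i _ hi (hF i' hi')
  obtain rfl := unique j _ hj (hF j' hj')
  obtain ⟨q', rfl⟩ := F.map_surjective q
  obtain ⟨v', rfl⟩ := F.map_surjective v
  exact ⟨c', d', q', v', j', ⟨i', hi', F.map_injective (by rw [F.map_comp, hiq, F.map_id])⟩,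
    isIso_of_fully_faithful F v', hj', F.map_injective (by rw [F.map_comp, F.map_comp, fac])⟩

theorem InclusionPreserving.isNormalCategory (hF : InclusionPreserving F)
    (hsub : LiftsSubobjects F) [IsNormalCategory D] : IsNormalCategory C where
  exists_factorization f :=
    (IsNormalCategory.exists_factorization (F.map f)).elim (hF.nonempty_normalFactorization hsub f)
  incl_splits j hj := by
    obtain ⟨q, hq⟩ := IsNormalCategory.incl_splits (F.map j) (hF j hj)
    obtain ⟨q', rfl⟩ := F.map_surjective q
    exact ⟨q', F.map_injective (by rw [F.map_comp, hq, F.map_id])⟩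
  exists_cone c := by
    obtain ⟨γ, hγ, hγc⟩ := IsNormalCategory.exists_cone (F.obj c)
    have hid : F.preimage (γ (F.obj c)) = 𝟙 c := by rw [hγc, F.preimage_id]
    refine ⟨fun a => F.preimage (γ (F.obj a)), ⟨fun j hj => F.map_injective ?_, c, ?_⟩, hid⟩
    · rw [F.map_comp, F.map_preimage, F.map_preimage, hγ.incl_comp _ (hF j hj)]
    · rw [hid]
      infer_instance

theorem InclusionPreserving.isLocalIsomorphism (hF : InclusionPreserving F)
    (hsub : LiftsSubobjects F) [IsNormalCategory D] : IsLocalIsomorphism F where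
  normal_source := hF.isNormalCategory hsub
  normal_target := inferInstance
  inclusionPreserving := hF
  full := inferInstance
  faithful := inferInstance
  iso_on_ideals := hF.isCategoryIso_restrictIdeal hsub

end LocalIsomorphism

section NormalDual

/-- Morphisms in `SubsetCat X` are arbitrary functions, so a natural transformation between
functors to `SubsetCat X` may be computed in the category of types. -/
def SubsetCat.fullyFaithfulToType (X : Type u) :
    (SubsetCat.toType X).FullyFaithful where
  preimage f := fun x => f x

variable {C : Type u} [SmallCategory C] [CategoryWithSubobjects C]

theorem IsNormalCone.isSplitEpi_of_comp_eq {d d' : C} {γ : ∀ c : C, c ⟶ d} (hγ : IsNormalCone γ)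
    {δ : ∀ c : C, c ⟶ d'} {r : d' ⟶ d} (h : ∀ k, δ k ≫ r = γ k) : IsSplitEpi r := by
  obtain ⟨c, hc⟩ := hγ.exists_isIso
  exact ⟨⟨inv (γ c) ≫ δ c, by rw [Category.assoc, h, IsIso.inv_hom_id]⟩⟩

variable [IsNormalCategory C]

theorem Hmap_bijective (γ δ : NormalCone C) : Function.Bijective (Hmap γ δ) :=
  (Quiver.Hom.opEquiv.trans <| Coyoneda.fullyFaithful.homEquiv.trans <|
    ((eta γ).homCongr (eta δ)).symm.trans <|
    ((SubsetCat.fullyFaithfulToType (NormalCone C)).whiskeringRight C).homEquiv.symm.trans <|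
    ((ObjectProperty.fullyFaithfulι _).homEquiv
      (X := Hobj γ) (Y := Hobj δ)).symm).bijective

/-- The element `γ ∗ f°` of `H(γ; c)`. -/
noncomputable def NormalCone.elt (γ : NormalCone C) {c : C} (f : γ.apex ⟶ c) :
    ((Hobj γ).obj.obj c).carrier :=
  ⟨γ.starEpi f, f, rfl⟩

theorem NormalCone.coe_elt (γ : NormalCone C) {c : C} (f : γ.apex ⟶ c) :
    (γ.elt f : NormalCone C) = γ.starEpi f :=
  rfl

theorem NormalCone.exists_elt_eq {γ : NormalCone C} {c : C} (x : ((Hobj γ).obj.obj c).carrier) :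
    ∃ f, γ.elt f = x := by
  obtain ⟨_, f, rfl⟩ := x
  exact ⟨f, rfl⟩

theorem Hmap_app_elt {γ δ : NormalCone C} (r : δ.apex ⟶ γ.apex) {c : C} (f : γ.apex ⟶ c) :
    NormalDual.app (Hmap γ δ r) c (γ.elt f) = δ.elt (r ≫ f) :=
  Subtype.ext (Hmap_app γ δ r f ⟨f, rfl⟩)

theorem Hmap_id (γ : NormalCone C) : Hmap γ γ (𝟙 γ.apex) = 𝟙 (Hobj γ) := by
  refine NormalDual.hom_ext' fun c x => ?_
  obtain ⟨f, rfl⟩ := NormalCone.exists_elt_eq x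
  rw [Hmap_app_elt, Category.id_comp, NormalDual.app_id]

theorem Hmap_comp {γ δ ε : NormalCone C} (r : δ.apex ⟶ γ.apex) (s : ε.apex ⟶ δ.apex) :
    Hmap γ δ r ≫ Hmap δ ε s = Hmap γ ε (s ≫ r) := by
  refine NormalDual.hom_ext' fun c x => ?_
  obtain ⟨f, rfl⟩ := NormalCone.exists_elt_eq x
  rw [NormalDual.app_comp, Hmap_app_elt, Hmap_app_elt, Hmap_app_elt, Category.assoc]

instance isIso_Hmap (γ δ : NormalCone C) (r : δ.apex ⟶ γ.apex) [IsIso r] : IsIso (Hmap γ δ r) :=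
  ⟨Hmap δ γ (inv r), by rw [Hmap_comp, IsIso.inv_hom_id, Hmap_id],
    by rw [Hmap_comp, IsIso.hom_inv_id, Hmap_id]⟩

theorem incl_Hmap_iff {γ δ : NormalCone C} {r : δ.apex ⟶ γ.apex} :
    Incl (Hmap γ δ r) ↔ ∀ k, δ.comp k ≫ r = γ.comp k := by
  constructor
  · intro h k
    have hid : δ.starEpi (r ≫ 𝟙 γ.apex) = γ.starEpi (𝟙 γ.apex) := by
      rw [← NormalCone.coe_elt, ← NormalCone.coe_elt, ← Hmap_app_elt, h]
    simpa only [Category.comp_id] using (starEpi_eq_iff _ _ _ _).1 hid k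
  · intro h c x
    obtain ⟨f, rfl⟩ := NormalCone.exists_elt_eq x
    rw [Hmap_app_elt, NormalCone.coe_elt, NormalCone.coe_elt, starEpi_eq_iff]
    intro k
    rw [← Category.assoc, h]

theorem NormalDual.exists_Hobj_eq (F : NormalDual C) : ∃ γ : NormalCone C, Hobj γ = F := by
  obtain ⟨_, γ, rfl⟩ := F
  exact ⟨γ, rfl⟩

theorem Hobj_eq_of_iso {γ δ : NormalCone C} (φ : γ.apex ≅ δ.apex)
    (h : ∀ a, γ.comp a ≫ φ.hom = δ.comp a) : Hobj γ = Hobj δ :=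
  Hobj_eq γ δ φ.hom φ.inv h fun a => by rw [← h, Category.assoc, φ.hom_inv_id, Category.comp_id]

theorem NormalDual.exists_Hobj_eq_of_comp_apex_eq_id (F : NormalDual C) :
    ∃ ε : NormalCone C, Hobj ε = F ∧ ε.comp ε.apex = 𝟙 ε.apex := by
  obtain ⟨γ, rfl⟩ := F.exists_Hobj_eq
  obtain ⟨c, hc⟩ := γ.isNormal.exists_isIso
  have hγ : Hobj γ = Hobj (γ.star (inv (γ.comp c))) :=
    Hobj_eq_of_iso (δ := γ.star (inv (γ.comp c))) (asIso (γ.comp c)).symm fun _ => rfl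
  exact ⟨γ.star (inv (γ.comp c)), hγ.symm, IsIso.hom_inv_id (γ.comp c)⟩

/-- The product `ε · x = ε ∗ (x(c_ε))°` of the semigroup `TC` of normal cones. -/
noncomputable def NormalCone.mul (ε x : NormalCone C) : NormalCone C :=
  ε.starEpi (x.comp ε.apex)

theorem starEpi_comp_incl (γ : NormalCone C) {c d : C} (f : γ.apex ⟶ c) {j : c ⟶ d}
    (hj : Incl j) : γ.starEpi (f ≫ j) = γ.starEpi f := by
  refine NormalCone.ext_of_incl _ _ (imIncl (f ≫ j)) (imIncl f ≫ j) (incl_imIncl _)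
    (comp_mem _ _ (incl_imIncl f) hj) fun k => ?_
  have hk := starEpi_comp_imIncl γ f k
  rw [starEpi_comp_imIncl γ (f ≫ j) k, ← Category.assoc (γ.comp k), ← hk]
  exact Category.assoc _ _ _

theorem mul_starEpi (ε γ : NormalCone C) {c : C} (f : γ.apex ⟶ c) :
    ε.mul (γ.starEpi f) = ε.starEpi (γ.comp ε.apex ≫ f) :=
  (starEpi_comp_incl ε ((γ.starEpi f).comp ε.apex) (incl_imIncl f)).symm.trans
    (congrArg ε.starEpi (starEpi_comp_imIncl γ f ε.apex))

theorem NormalDual.exists_app_eq_mul (ε : NormalCone C) (F : NormalDual C) :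
    ∃ t : F ⟶ Hobj ε, ∀ c x, (NormalDual.app t c x : NormalCone C) = ε.mul x := by
  obtain ⟨γ, rfl⟩ := F.exists_Hobj_eq
  refine ⟨Hmap γ ε (γ.comp ε.apex), fun c x => ?_⟩
  obtain ⟨f, rfl⟩ := NormalCone.exists_elt_eq x
  rw [Hmap_app_elt, NormalCone.coe_elt, NormalCone.coe_elt, mul_starEpi]

theorem NormalDual.exists_normalCone_Hobj {ε : NormalCone C} (hε : ε.comp ε.apex = 𝟙 ε.apex) :
    ∃ Φ : ∀ F : NormalDual C, F ⟶ Hobj ε, IsNormalCone Φ ∧ Φ (Hobj ε) = 𝟙 (Hobj ε) := by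
  choose Φ hΦ using NormalDual.exists_app_eq_mul ε
  have hid : Φ (Hobj ε) = 𝟙 (Hobj ε) := by
    refine NormalDual.hom_ext' fun c x => ?_
    obtain ⟨f, rfl⟩ := NormalCone.exists_elt_eq x
    rw [hΦ, NormalCone.coe_elt, mul_starEpi, hε, Category.id_comp, NormalDual.app_id,
      NormalCone.coe_elt]
  refine ⟨Φ, ⟨fun j hj => NormalDual.hom_ext' fun c x => ?_, Hobj ε, ?_⟩, hid⟩
  · rw [NormalDual.app_comp, hΦ, hΦ, hj c x]
  · rw [hid]
    infer_instance

theorem nonempty_normalFactorization_Hmap {γ γ' δ δ' : NormalCone C}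
    {q : δ.apex ⟶ δ'.apex} {v : δ'.apex ⟶ γ'.apex} {j : γ'.apex ⟶ γ.apex} {p : γ.apex ⟶ γ'.apex}
    (hδ : ∀ k, δ.comp k ≫ q = δ'.comp k) (hv : IsIso v) (hjp : j ≫ p = 𝟙 _)
    (hγ : ∀ k, γ.comp k ≫ p = γ'.comp k) :
    Nonempty (NormalFactorization (Hmap γ δ (q ≫ v ≫ j))) :=
  ⟨⟨Hobj γ', Hobj δ', Hmap γ γ' j, Hmap γ' δ' v, Hmap δ' δ q,
    ⟨Hmap γ' γ p, incl_Hmap_iff.2 hγ, by rw [Hmap_comp, hjp, Hmap_id]⟩, isIso_Hmap _ _ v,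
    incl_Hmap_iff.2 hδ, by rw [Hmap_comp, Hmap_comp, Category.assoc]⟩⟩

instance isNormalCategory_normalDual : IsNormalCategory (NormalDual C) where
  exists_factorization {F G} t := by
    obtain ⟨γ, rfl⟩ := F.exists_Hobj_eq
    obtain ⟨δ, rfl⟩ := G.exists_Hobj_eq
    obtain ⟨r, rfl⟩ := (Hmap_bijective γ δ).surjective t
    obtain ⟨⟨d', c', q, v, j, ⟨i, _, hiq⟩, hv, hj, rfl⟩⟩ :=
      IsNormalCategory.exists_factorization r
    obtain ⟨p, hjp⟩ := IsNormalCategory.incl_splits j hj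
    have : IsSplitEpi p := ⟨⟨j, hjp⟩⟩
    have : IsSplitEpi q := ⟨⟨i, hiq⟩⟩
    exact nonempty_normalFactorization_Hmap (γ' := γ.star p) (δ' := δ.star q)
      (fun _ => rfl) hv hjp (fun _ => rfl)
  incl_splits {F G} j hj := by
    obtain ⟨γ, rfl⟩ := F.exists_Hobj_eq
    obtain ⟨δ, rfl⟩ := G.exists_Hobj_eq
    obtain ⟨r, rfl⟩ := (Hmap_bijective γ δ).surjective j
    have := γ.isNormal.isSplitEpi_of_comp_eq (incl_Hmap_iff.1 hj)
    exact ⟨Hmap δ γ (section_ r), by rw [Hmap_comp, IsSplitEpi.id, Hmap_id]⟩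
  exists_cone F := by
    obtain ⟨ε, rfl, hε⟩ := F.exists_Hobj_eq_of_comp_apex_eq_id
    exact NormalDual.exists_normalCone_Hobj hε

end NormalDual

section LG

variable {S : Type u} [Semigroup S] [IsRegularSemigroup S]

theorem principalComp_comp_r (g e : Idem S) {u : S} {f : Idem S} {b : LG S}
    (h1 : e.val * u = u) (h2 : u * f.val = u) (hb : LG.of f = b) :
    principalComp e (LG.of g) ≫ LG.r e u f h1 h2 rfl hb =
      LG.r g (g.val * u) f (by rw [← mul_assoc, g.idem]) (by rw [mul_assoc, h2]) rfl hb := by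
  rw [principalComp_eq e g rfl, LG.r_comp, LG.r_eq_iff, mul_assoc, h1, ← mul_assoc, g.idem]

theorem exists_principalComp_comp_eq_of_isSplitEpi {h : Idem S} {b : LG S}
    (r : LG.of h ⟶ b) [IsSplitEpi r] : ∃ (e : Idem S) (φ : LG.of e ≅ b), OmegaR e h ∧
      ∀ a, principalComp e a ≫ φ.hom = principalComp h a ≫ r := by
  obtain ⟨s, hs⟩ : ∃ s, s ≫ r = 𝟙 b := ⟨section_ r, IsSplitEpi.id r⟩
  obtain ⟨f, rfl⟩ := LG.exists_rep b
  obtain ⟨w, hw, wf, rfl⟩ := LG.exists_r r h f rfl rfl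
  obtain ⟨v, fv, vh, rfl⟩ := LG.exists_r s f h rfl rfl
  have vw : v * w = f.val := by
    rwa [LG.r_comp, LG.id_eq f rfl, LG.r_eq_iff, f.idem] at hs
  let e : Idem S := ⟨w * v, by rw [mul_assoc, ← mul_assoc v, vw, fv]⟩
  have ew : e.val * w = w := by rw [mul_assoc, vw, wf]
  have ve : v * e.val = v := by rw [← mul_assoc, vw, fv]
  let φ : LG.of e ≅ LG.of f :=
    { hom := LG.r e w f ew wf rfl rfl
      inv := LG.r f v e fv ve rfl rfl
      hom_inv_id := by rw [LG.r_comp, LG.id_eq e rfl, LG.r_eq_iff, e.idem]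
      inv_hom_id := by rw [LG.r_comp, LG.id_eq f rfl, LG.r_eq_iff, f.idem, vw] }
  refine ⟨e, φ, (mul_assoc _ _ _).symm.trans (congrArg (· * v) hw), fun a => ?_⟩
  obtain ⟨x, rfl⟩ := LG.exists_rep a
  exact (principalComp_comp_r x e ew wf rfl).trans (principalComp_comp_r x h hw wf rfl).symm

end LG

section Gamma

variable {S : Type u} [Semigroup S] [IsRegularSemigroup S]

theorem RG.isSub_of_omegaR {e f : Idem S} (h : OmegaR e f) : IsSub (RG.of e) (RG.of f) :=
  ⟨RG.l e e.val f h e.idem rfl rfl, RG.isIncl_l_iff.2 rfl⟩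

theorem gammaG_map_l {e f : Idem S} {u : S} (h1 : f.val * u = u) (h2 : u * e.val = u) :
    (gammaG S).map (RG.l e u f h1 h2 rfl rfl) =
      Hmap (principalCone e) (principalCone f) (LG.r f u e h1 h2 rfl rfl) :=
  gammaMap_l e u f h1 h2

theorem inclusionPreserving_gammaG : InclusionPreserving (gammaG S) := by
  intro a b j hj
  obtain ⟨e, rfl⟩ := RG.exists_rep a
  obtain ⟨f, rfl⟩ := RG.exists_rep b
  obtain ⟨u, h1, h2, rfl⟩ := RG.exists_l j e f rfl rfl
  obtain rfl : u = e.val := RG.isIncl_l_iff.1 hj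
  rw [gammaG_map_l]
  refine incl_Hmap_iff.2 fun k => ?_
  obtain ⟨g, rfl⟩ := LG.exists_rep k
  exact (principalComp_comp_r g f h1 h2 rfl).trans (principalCone_comp e g).symm

instance full_gammaG : (gammaG S).Full where
  map_surjective {a b} t := by
    obtain ⟨e, rfl⟩ := RG.exists_rep a
    obtain ⟨f, rfl⟩ := RG.exists_rep b
    obtain ⟨r, rfl⟩ := (Hmap_bijective (principalCone e) (principalCone f)).surjective t
    obtain ⟨u, h1, h2, rfl⟩ := LG.exists_r r f e rfl rfl
    exact ⟨RG.l e u f h1 h2 rfl rfl, gammaG_map_l h1 h2⟩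

instance faithful_gammaG : (gammaG S).Faithful where
  map_injective {a b} φ ψ h := by
    obtain ⟨e, rfl⟩ := RG.exists_rep a
    obtain ⟨f, rfl⟩ := RG.exists_rep b
    obtain ⟨u, h1, h2, rfl⟩ := RG.exists_l φ e f rfl rfl
    obtain ⟨v, h3, h4, rfl⟩ := RG.exists_l ψ e f rfl rfl
    rw [gammaG_map_l, gammaG_map_l] at h
    have huv : u = f.val * v := LG.r_eq_iff.1 ((Hmap_bijective _ _).injective h)
    rw [RG.l_eq_iff, h4, huv, h3]

theorem liftsSubobjects_gammaG : LiftsSubobjects (gammaG S) := by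
  rintro c X ⟨j, hj⟩
  obtain ⟨h, rfl⟩ := RG.exists_rep c
  obtain ⟨γ, rfl⟩ := X.exists_Hobj_eq
  obtain ⟨r, rfl⟩ := (Hmap_bijective γ (principalCone h)).surjective j
  have hr := incl_Hmap_iff.1 hj
  have := γ.isNormal.isSplitEpi_of_comp_eq hr
  obtain ⟨e, φ, heh, hφ⟩ := exists_principalComp_comp_eq_of_isSplitEpi r
  exact ⟨RG.of e, RG.isSub_of_omegaR heh,
    Hobj_eq_of_iso (γ := principalCone e) φ fun a => (hφ a).trans (hr a)⟩

end Gamma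

end CrossConn

theorem mainTheorem5 (S : Type*) [Semigroup S] [CrossConn.IsRegularSemigroup S] :
    CrossConn.IsLocalIsomorphism (CrossConn.gammaG S) :=
  CrossConn.inclusionPreserving_gammaG.isLocalIsomorphism CrossConn.liftsSubobjects_gammaG
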